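/- Let $(M,g)$ be a (pseudo-)Riemannian manifold with Levi-Civita connection $\nabla$, and let $S\to M$ be a (real or complex) spinor bundle, with Clifford multiplication $\gamma:TM\to\mathrm{End}(S)$, $\gamma(X)\gamma(Y)+\gamma(Y)\gamma(X)=-2g(X,Y)$, and charge conjugation $C$, i.e. a smooth non-degenerate bilinear form on $S$ with $C(\eta,\xi)=\Delta_0C(\xi,\eta)$ and $C(\eta,\gamma(X)\xi)=\Delta_1C(\xi,\gamma(X)\eta)$ for signs $\Delta_0,\Delta_1\in\{\pm1\}$. (The fibres of $S$ need not be irreducible Clifford modules.) For an endomorphism field $\Omega$ of $S$ let $\Omega^C$ be defined by $C(\Omega^C\eta,\xi)=C(\eta,\Omega\xi)$, and put $\mathrm{ad}^C(\Omega)\Phi=\mathrm{ad}^C_\Omega\Phi:=\Omega\Phi+\Phi\,\Omega^C$ for $\Phi\in\Gamma\,\mathrm{End}(S)$. Let $D$ be any connection on $S$, with curvature $R(X,Y)=[D_X,D_Y]-D_{[X,Y]}$. Let $D^C$ be the connection on $S$ determined by $X\,C(\eta,\xi)=C(D_X\eta,\xi)+C(\eta,D^C_X\xi)$. For an $\mathrm{End}(S)$-valued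 covariant tensor $\Phi$ of order $k$ define $$(\hat D_Z\Phi)(X_1,\dots,X_k)\xi:=D_Z\big(\Phi(X_1,\dots,X_k)\xi\big)-\sum_{i=1}^k\Phi(X_1,\dots,\nabla_ZX_i,\dots,X_k)\xi-\Phi(X_1,\dots,X_k)D^C_Z\xi ,$$ and let $D_Z\Phi$ be given by the same formula with $D^C$ replaced by $D$. Let square brackets around indices denote skew symmetrization with the factor $1/k!$, let $(\mathrm{ad}^C_R\gamma)_{\mu\nu\rho}:=\mathrm{ad}^C(R_{\mu\nu})\gamma_\rho$, and let the torsion of $D$ be twice the skew part of $\hat D\gamma$, i.e. $\mathcal T_{\mu\nu}:=2\hat D_{[\mu}\gamma_{\nu]}$. Then $$\hat D_{[\kappa}\mathcal T_{\mu\nu]}=\mathrm{ad}^C(R_{[\kappa\mu})\gamma_{\nu]},\qquad \hat D_{[\kappa}(\mathrm{ad}^C_R\gamma)_{\mu\nu\rho]}=\tfrac12\,\mathrm{ad}^C(R_{[\kappa\mu})\mathcal T_{\nu\rho]},\qquad D_{[\kappa}R_{\mu\nu]}=0 .$$ -/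

import Mathlib

open Bundle Manifold
open scoped ContDiff

noncomputable section

namespace SpinorTorsion

/-! ### Smooth sections, vector fields and connections

`M` is a finite-dimensional smooth manifold without boundary, modelled on the real vector space `E`.
A bundle over `M` is used through its `C^∞(M)`-module of global smooth sections. -/

section Connections

variable {E : Type*} [NormedAddCommGroup E] [NormedSpace ℝ E] [FiniteDimensional ℝ E]
  {M : Type*} [TopologicalSpace M] [ChartedSpace E M] [IsManifold 𝓘(ℝ, E) ∞ M]

variable (E M) in
/-- Smooth vector fields on `M`. -/
abbrev VField := Cₛ^∞⟮𝓘(ℝ, E); E, (TangentSpace 𝓘(ℝ, E) : M → Type _)⟯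

/-- The Lie bracket `[X, Y]` of smooth vector fields. -/
def lieBracket (X Y : VField E M) : VField E M :=
  ⟨VectorField.mlieBracket 𝓘(ℝ, E) X Y, by
    have : IsManifold 𝓘(ℝ, E) (((⊤ : ℕ∞) : ℕ∞ω) + 1) M := by
      simpa using (inferInstance : IsManifold 𝓘(ℝ, E) ∞ M)
    have : IsManifold 𝓘(ℝ, E) (minSmoothness ℝ 2) M := by
      simpa using (inferInstance : IsManifold 𝓘(ℝ, E) 2 M)
    exact ContDiff.mlieBracket_vectorField (m := ⊤) (n := ⊤) X.contMDiff Y.contMDiff (by simp)⟩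

variable {F : Type*} [NormedAddCommGroup F] [NormedSpace ℝ F]
  {S : M → Type*} [TopologicalSpace (TotalSpace F S)]
  [∀ x, AddCommGroup (S x)] [∀ x, Module ℝ (S x)]
  [∀ x, TopologicalSpace (S x)] [∀ x, IsTopologicalAddGroup (S x)] [∀ x, ContinuousSMul ℝ (S x)]
  [FiberBundle F S] [VectorBundle ℝ F S]

/-- `∇_X ξ`, as a smooth section, for a smooth connection `∇` on a vector bundle. -/
def along [ContMDiffVectorBundle ∞ F S 𝓘(ℝ, E)]
    (D : CovariantDerivative 𝓘(ℝ, E) F S) (hD : D.ContMDiffCovariantDerivative ∞)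
    (X : VField E M) (ξ : Cₛ^∞⟮𝓘(ℝ, E); F, S⟯) : Cₛ^∞⟮𝓘(ℝ, E); F, S⟯ :=
  ⟨fun x ↦ D ξ x (X x), by
    have h := hD.contMDiff.contMDiff (σ := ξ)
      (by simpa using ξ.contMDiff.contMDiffOn (s := Set.univ))
    exact ContMDiff.clm_bundle_apply (contMDiffOn_univ.mp h) X.contMDiff⟩

variable (E M) in
/-- A pseudo-Riemannian metric on `M`: a smooth family of non-degenerate symmetric bilinear forms
(of any signature) on the tangent spaces. -/
structure PseudoRiemannianMetric where
  val : ∀ x : M, LinearMap.BilinForm ℝ (TangentSpace 𝓘(ℝ, E) x)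
  symm : ∀ x v w, val x v w = val x w v
  nondegenerate : ∀ x, (val x).Nondegenerate
  contMDiff : ∀ X Y : VField E M, ContMDiff 𝓘(ℝ, E) 𝓘(ℝ, ℝ) ∞ fun x ↦ val x (X x) (Y x)

/-- `nabla` is the Levi-Civita connection of `g`: it is smooth, torsion free, and
`Z g(X, Y) = g(∇_Z X, Y) + g(X, ∇_Z Y)`. -/
structure IsLeviCivita (g : PseudoRiemannianMetric E M)
    (nabla : CovariantDerivative 𝓘(ℝ, E) E (TangentSpace 𝓘(ℝ, E) : M → Type _)) : Prop where
  contMDiff : nabla.ContMDiffCovariantDerivative ∞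
  torsion_eq_zero : nabla.torsion = 0
  metric : ∀ (Z X Y : VField E M) (x : M),
    mvfderiv 𝓘(ℝ, E) (fun y ↦ g.val y (X y) (Y y)) x (Z x) =
      g.val x (nabla X x (Z x)) (Y x) + g.val x (X x) (nabla Y x (Z x))

end Connections

/-! ### Spinor bundles and spinor connections

Spinors are real or complex: the scalar field of the fibres is `𝕜`, with `𝕜 = ℝ` or `𝕜 = ℂ`. The
bundle `S` is a smooth real vector bundle whose trivializations are moreover `𝕜`-linear. -/

section Spinors

variable (𝕜 : Type*) [RCLike 𝕜]
  {E : Type*} [NormedAddCommGroup E] [NormedSpace ℝ E] [FiniteDimensional ℝ E]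
  {M : Type*} [TopologicalSpace M] [ChartedSpace E M] [IsManifold 𝓘(ℝ, E) ∞ M]
  (F : Type*) [NormedAddCommGroup F] [NormedSpace ℝ F]
  (S : M → Type*) [TopologicalSpace (TotalSpace F S)]
  [∀ x, AddCommGroup (S x)] [∀ x, Module ℝ (S x)] [∀ x, Module 𝕜 (S x)]
  [∀ x, IsScalarTower ℝ 𝕜 (S x)]
  [∀ x, TopologicalSpace (S x)] [∀ x, IsTopologicalAddGroup (S x)] [∀ x, ContinuousSMul ℝ (S x)]
  [FiberBundle F S] [VectorBundle ℝ F S]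

/-- The structure of a spinor bundle over `(M, g)` on the vector bundle `S`: a Clifford
multiplication `γ` with `γ(X)γ(Y) + γ(Y)γ(X) = -2 g(X, Y)` and a charge conjugation `C`, i.e. a
smooth non-degenerate bilinear form with symmetries `C(η, ξ) = Δ₀ C(ξ, η)` and
`C(η, γ(X) ξ) = Δ₁ C(ξ, γ(X) η)`, where `Δ₀, Δ₁ ∈ {1, -1}` (so that `C` is invariant under
the identity component of the spin group). No irreducibility of the fibres is required, so that sums of
copies of the spinor bundle are covered as well. -/
structure SpinorStructure (g : PseudoRiemannianMetric E M) where
  γ : ∀ x : M, TangentSpace 𝓘(ℝ, E) x →ₗ[ℝ] Module.End 𝕜 (S x)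
  clifford : ∀ x v w, γ x v * γ x w + γ x w * γ x v = (-2 * g.val x v w) • (1 : Module.End 𝕜 (S x))
  contMDiff_γ : ∀ (X : VField E M) (ξ : Cₛ^∞⟮𝓘(ℝ, E); F, S⟯),
    ContMDiff 𝓘(ℝ, E) (𝓘(ℝ, E).prod 𝓘(ℝ, F)) ∞ fun x ↦ TotalSpace.mk' F x (γ x (X x) (ξ x))
  C : ∀ x : M, LinearMap.BilinForm 𝕜 (S x)
  nondegenerate : ∀ x, (C x).Nondegenerate
  contMDiff_C : ∀ η ξ : Cₛ^∞⟮𝓘(ℝ, E); F, S⟯,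
    ContMDiff 𝓘(ℝ, E) 𝓘(ℝ, 𝕜) ∞ fun x ↦ C x (η x) (ξ x)
  Δ₀ : ℤˣ
  Δ₁ : ℤˣ
  symm₀ : ∀ x η ξ, C x η ξ = (Δ₀ : ℤ) • C x ξ η
  symm₁ : ∀ x v η ξ, C x η (γ x v ξ) = (Δ₁ : ℤ) • C x ξ (γ x v η)

variable (E) in
/-- A smooth `𝕜`-linear connection on `S`. -/
structure SpinorConnection extends CovariantDerivative 𝓘(ℝ, E) F S where
  contMDiff : toCovariantDerivative.ContMDiffCovariantDerivative ∞
  smul_const : ∀ (c : 𝕜) (ξ : Cₛ^∞⟮𝓘(ℝ, E); F, S⟯) (x : M) (v : TangentSpace 𝓘(ℝ, E) x),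
    toFun (fun y ↦ c • ξ y) x v = c • toFun ξ x v

variable (E) in
/-- Covariant tensors of order `k` with values in `End(S)`, as operators
`(X₁, …, X_k, ξ) ↦ Φ(X₁, …, X_k) ξ` on vector fields and sections of `S`. -/
abbrev EndTensor (k : ℕ) :=
  (Fin k → VField E M) → Cₛ^∞⟮𝓘(ℝ, E); F, S⟯ → Cₛ^∞⟮𝓘(ℝ, E); F, S⟯

variable {𝕜 F S}

/-- Normalized skew symmetrization,
`Φ_{[μ₁…μ_k]} = (1/k!) ∑_σ sign(σ) Φ_{μ_{σ(1)}…μ_{σ(k)}}`. -/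
def alt {k : ℕ} (Φ : EndTensor E F S k) : EndTensor E F S k := fun X ξ ↦
  (k.factorial : ℝ)⁻¹ • ∑ σ : Equiv.Perm (Fin k), (Equiv.Perm.sign σ : ℤ) • Φ (X ∘ σ) ξ

/-- The covariant derivative of `End(S)`-valued tensors induced by `D₁` and `D₂` on `S` and `∇` on
vector fields: `(Z, X) ↦ D₁_Z (Φ(X)ξ) - Φ(∇_Z X)ξ - Φ(X) D₂_Z ξ`, where
`Φ(∇_Z X) = ∑ᵢ Φ(X₁, …, ∇_Z Xᵢ, …, X_k)`. The differentiating field `Z` is the first argument. -/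
def inducedD (nabla : VField E M → VField E M → VField E M)
    (D₁ D₂ : VField E M → Cₛ^∞⟮𝓘(ℝ, E); F, S⟯ → Cₛ^∞⟮𝓘(ℝ, E); F, S⟯)
    {k : ℕ} (Φ : EndTensor E F S k) : EndTensor E F S (k + 1) := fun W ξ ↦
  let Z : VField E M := W 0
  let X : Fin k → VField E M := fun i ↦ W i.succ
  D₁ Z (Φ X ξ) - ∑ i, Φ (Function.update X i (nabla Z (X i))) ξ - Φ X (D₂ Z ξ)

/-- The curvature `R(X, Y) ξ = D_X D_Y ξ - D_Y D_X ξ - D_{[X, Y]} ξ`. -/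
def curvature (D : VField E M → Cₛ^∞⟮𝓘(ℝ, E); F, S⟯ → Cₛ^∞⟮𝓘(ℝ, E); F, S⟯) : EndTensor E F S 2 :=
  fun X ξ ↦ D (X 0) (D (X 1) ξ) - D (X 1) (D (X 0) ξ) - D (lieBracket (X 0) (X 1)) ξ

namespace SpinorStructure

variable {g : PseudoRiemannianMetric E M} (𝒮 : SpinorStructure 𝕜 F S g)

/-- Clifford multiplication as an `End(S)`-valued one-form. -/
def gamma : EndTensor E F S 1 := fun X ξ ↦ ⟨fun x ↦ 𝒮.γ x (X 0 x) (ξ x), 𝒮.contMDiff_γ (X 0) ξ⟩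

/-- The charge adjoint `Ω^C` of an endomorphism field `Ω`: `Ω^C ξ` is the (unique) section with
`C(Ω^C ξ, η) = C(ξ, Ω η)` for all sections `η`. -/
def chargeAdjoint (Ω : Cₛ^∞⟮𝓘(ℝ, E); F, S⟯ → Cₛ^∞⟮𝓘(ℝ, E); F, S⟯)
    (ξ : Cₛ^∞⟮𝓘(ℝ, E); F, S⟯) : Cₛ^∞⟮𝓘(ℝ, E); F, S⟯ :=
  Classical.epsilon fun ζ : Cₛ^∞⟮𝓘(ℝ, E); F, S⟯ ↦
    ∀ (η : Cₛ^∞⟮𝓘(ℝ, E); F, S⟯) (x : M), 𝒮.C x (ζ x) (η x) = 𝒮.C x (ξ x) (Ω η x)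

/-- The connection `D^C`, for which `C` is parallel with respect to `D ⊗ 1 + 1 ⊗ D^C`:
`D^C_X ξ` is the (unique) section with `X C(η, ξ) = C(D_X η, ξ) + C(η, D^C_X ξ)` for all
sections `η`. -/
def chargeDual (D : VField E M → Cₛ^∞⟮𝓘(ℝ, E); F, S⟯ → Cₛ^∞⟮𝓘(ℝ, E); F, S⟯)
    (X : VField E M) (ξ : Cₛ^∞⟮𝓘(ℝ, E); F, S⟯) : Cₛ^∞⟮𝓘(ℝ, E); F, S⟯ :=
  Classical.epsilon fun ζ : Cₛ^∞⟮𝓘(ℝ, E); F, S⟯ ↦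
    ∀ (η : Cₛ^∞⟮𝓘(ℝ, E); F, S⟯) (x : M),
      mvfderiv 𝓘(ℝ, E) (fun y ↦ 𝒮.C y (η y) (ξ y)) x (X x) =
        𝒮.C x (D X η x) (ξ x) + 𝒮.C x (η x) (ζ x)

/-- `ad^C_Ω Φ = Ω Φ + Φ Ω^C` for an `End(S)`-valued two-tensor `Ω` and `k`-tensor `Φ`, as the
`(k + 2)`-tensor `ad^C(Ω_{μν}) Φ_{ρ…}`. -/
def adC (Ω : EndTensor E F S 2) {k : ℕ} (Φ : EndTensor E F S k) : EndTensor E F S (k + 2) :=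
  fun W ξ ↦
    let A := Ω ![W 0, W 1]
    let B := Φ fun i ↦ W i.succ.succ
    A (B ξ) + B (𝒮.chargeAdjoint A ξ)

end SpinorStructure

variable [ContMDiffVectorBundle ∞ F S 𝓘(ℝ, E)]

/-- `D_X ξ` for a spinor connection. -/
def SpinorConnection.apply (D : SpinorConnection 𝕜 E F S) :
    VField E M → Cₛ^∞⟮𝓘(ℝ, E); F, S⟯ → Cₛ^∞⟮𝓘(ℝ, E); F, S⟯ :=
  along D.toCovariantDerivative D.contMDiff

namespace SpinorStructure

variable {g : PseudoRiemannianMetric E M} (𝒮 : SpinorStructure 𝕜 F S g)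
  {nabla : CovariantDerivative 𝓘(ℝ, E) E (TangentSpace 𝓘(ℝ, E) : M → Type _)}
  (hLC : IsLeviCivita g nabla) (D : SpinorConnection 𝕜 E F S)

/-- The connection `D̂`:
`(D̂_Z Φ)(X) ξ = D_Z (Φ(X) ξ) - Φ(∇_Z X) ξ - Φ(X) D^C_Z ξ`, with `∇` the Levi-Civita connection. -/
def hatD {k : ℕ} (Φ : EndTensor E F S k) : EndTensor E F S (k + 1) :=
  inducedD (along nabla hLC.contMDiff) D.apply (𝒮.chargeDual D.apply) Φ

/-- The torsion of `D`: two times the skew symmetrization of `D̂γ`. -/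
def torsion : EndTensor E F S 2 := (2 : ℝ) • alt (𝒮.hatD hLC D 𝒮.gamma)

end SpinorStructure

end Spinors

end SpinorTorsion

end

/-!
`D̂` is the connection which `(S, D^C)` and `(S, D)` induce on `Hom(S, S)`, so its skew
symmetrization is an exterior covariant derivative. Its square is the commutator
`R Φ - Φ R^{D^C}`: the curvature of `∇` drops out by the algebraic Bianchi identity. Since `C` is
parallel for `D ⊗ 1 + 1 ⊗ D^C`, one has `R^C = -R^{D^C}`, hence `ad^C_R Φ` is the same commutator.
The first identity is the formula for the square, the third one the differential Bianchi identity,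
and the second one follows from the Leibniz rule for `D̂ (R Φ - Φ R^{D^C})`, in which the
derivatives of `R` and `R^{D^C}` vanish after skew symmetrization.
-/

noncomputable section

namespace SpinorTorsion

section LieBracket

variable {E : Type*} [NormedAddCommGroup E] [NormedSpace ℝ E]
  {M : Type*} [TopologicalSpace M] [ChartedSpace E M] [IsManifold 𝓘(ℝ, E) ∞ M]
  {W : Type*} [NormedAddCommGroup W] [NormedSpace ℝ W]

theorem contMDiff_mvfderiv {f : M → W} (hf : ContMDiff 𝓘(ℝ, E) 𝓘(ℝ, W) ∞ f) (X : VField E M) :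
    ContMDiff 𝓘(ℝ, E) 𝓘(ℝ, W) ∞ fun x ↦ mvfderiv 𝓘(ℝ, E) f x (X x) :=
  (contMDiff_snd_tangentBundle_modelSpace W 𝓘(ℝ, W)).comp
    ((hf.contMDiff_tangentMap (m := ∞) (by simp)).comp X.contMDiff)

theorem mvfderiv_continuousLinearMap_comp {M : Type*} [TopologicalSpace M] [ChartedSpace E M]
    {W' : Type*} [NormedAddCommGroup W'] [NormedSpace ℝ W'] (φ : W →L[ℝ] W') {f : M → W} {x : M}
    (hf : MDifferentiableAt 𝓘(ℝ, E) 𝓘(ℝ, W) f x) (v : TangentSpace 𝓘(ℝ, E) x) :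
    mvfderiv 𝓘(ℝ, E) (fun y ↦ φ (f y)) x v = φ (mvfderiv 𝓘(ℝ, E) f x v) := by
  have hφ : mfderiv 𝓘(ℝ, W) 𝓘(ℝ, W') φ (f x) = φ := mfderiv_eq_fderiv.trans φ.fderiv
  have h := mfderiv_comp x (g := φ) (I' := 𝓘(ℝ, W)) (I'' := 𝓘(ℝ, W')) φ.mdifferentiableAt hf
  rw [hφ] at h
  exact congrArg (fun T ↦ T v) h

/-- Product of a smooth function and a smooth section. -/
def functionSMul {F : Type*} [NormedAddCommGroup F] [NormedSpace ℝ F]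
    {M : Type*} [TopologicalSpace M] [ChartedSpace E M]
    {S : M → Type*} [TopologicalSpace (TotalSpace F S)] [∀ x, AddCommGroup (S x)]
    [∀ x, Module ℝ (S x)] [∀ x, TopologicalSpace (S x)] [FiberBundle F S] [VectorBundle ℝ F S]
    (f : M → ℝ) (hf : ContMDiff 𝓘(ℝ, E) 𝓘(ℝ, ℝ) ∞ f) (ξ : Cₛ^∞⟮𝓘(ℝ, E); F, S⟯) :
    Cₛ^∞⟮𝓘(ℝ, E); F, S⟯ :=
  ⟨f • ⇑ξ, hf.smul_section ξ.contMDiff⟩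

theorem functionSMul_apply {F : Type*} [NormedAddCommGroup F] [NormedSpace ℝ F]
    {M : Type*} [TopologicalSpace M] [ChartedSpace E M]
    {S : M → Type*} [TopologicalSpace (TotalSpace F S)] [∀ x, AddCommGroup (S x)]
    [∀ x, Module ℝ (S x)] [∀ x, TopologicalSpace (S x)] [FiberBundle F S] [VectorBundle ℝ F S]
    (f : M → ℝ) (hf : ContMDiff 𝓘(ℝ, E) 𝓘(ℝ, ℝ) ∞ f) (ξ : Cₛ^∞⟮𝓘(ℝ, E); F, S⟯) (x : M) :
    functionSMul f hf ξ x = f x • ξ x := rfl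

variable [FiniteDimensional ℝ E]

theorem lieBracket_jacobi (X Y Z : VField E M) :
    lieBracket X (lieBracket Y Z) =
      lieBracket (lieBracket X Y) Z + lieBracket Y (lieBracket X Z) := by
  have : IsManifold 𝓘(ℝ, E) (minSmoothness ℝ 3) M := by
    simpa using (inferInstance : IsManifold 𝓘(ℝ, E) 3 M)
  have hs (X : VField E M) : ContMDiff 𝓘(ℝ, E) (𝓘(ℝ, E).prod 𝓘(ℝ, E)) (minSmoothness ℝ 2)
      (fun y ↦ TotalSpace.mk' E y (X y)) := by
    refine X.contMDiff.of_le ?_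
    simp only [minSmoothness_of_isRCLikeNormedField]
    exact ENat.LEInfty.out
  ext x
  exact congrFun (VectorField.leibniz_identity_mlieBracket (hs X) (hs Y) (hs Z)) x

theorem lieBracket_add_right (X Y Z : VField E M) :
    lieBracket X (Y + Z) = lieBracket X Y + lieBracket X Z := by
  have : IsManifold 𝓘(ℝ, E) 2 M := inferInstance
  ext x
  exact VectorField.mlieBracket_add_right Y.mdifferentiableAt Z.mdifferentiableAt

theorem lieBracket_functionSMul_right (X Z : VField E M) {f : M → ℝ}
    (hf : ContMDiff 𝓘(ℝ, E) 𝓘(ℝ, ℝ) ∞ f) :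
    lieBracket X (functionSMul f hf Z) =
      functionSMul _ (contMDiff_mvfderiv hf X) Z + functionSMul f hf (lieBracket X Z) := by
  have : IsManifold 𝓘(ℝ, E) 2 M := inferInstance
  ext x
  exact VectorField.mlieBracket_smul_right ((hf x).mdifferentiableAt (by simp))
    Z.mdifferentiableAt

-- A consequence of the Jacobi identity for `X`, `Y` and `f Z`.
theorem mvfderiv_lieBracket_sub_smul {f : M → ℝ} (hf : ContMDiff 𝓘(ℝ, E) 𝓘(ℝ, ℝ) ∞ f)
    (X Y Z : VField E M) (x : M) :
    (mvfderiv 𝓘(ℝ, E) f x (lieBracket X Y x) -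
      (mvfderiv 𝓘(ℝ, E) (fun y ↦ mvfderiv 𝓘(ℝ, E) f y (Y y)) x (X x) -
        mvfderiv 𝓘(ℝ, E) (fun y ↦ mvfderiv 𝓘(ℝ, E) f y (X y)) x (Y x))) • Z x = 0 := by
  have hJ := DFunLike.congr_fun (lieBracket_jacobi X Y (functionSMul f hf Z)) x
  simp only [lieBracket_functionSMul_right, lieBracket_add_right, ContMDiffSection.coe_add,
    Pi.add_apply, functionSMul_apply, lieBracket_jacobi X Y Z] at hJ
  rw [← sub_eq_zero] at hJ
  rw [← neg_eq_zero, ← hJ]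
  module

theorem mvfderiv_lieBracket_real {f : M → ℝ} (hf : ContMDiff 𝓘(ℝ, E) 𝓘(ℝ, ℝ) ∞ f)
    (X Y : VField E M) (x : M) :
    mvfderiv 𝓘(ℝ, E) f x (lieBracket X Y x) =
      mvfderiv 𝓘(ℝ, E) (fun y ↦ mvfderiv 𝓘(ℝ, E) f y (Y y)) x (X x) -
        mvfderiv 𝓘(ℝ, E) (fun y ↦ mvfderiv 𝓘(ℝ, E) f y (X y)) x (Y x) := by
  have key (Z : VField E M) (hZ : Z x ≠ 0) := sub_eq_zero.mp <|
    (smul_eq_zero.mp (mvfderiv_lieBracket_sub_smul hf X Y Z x)).resolve_right hZ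
  by_cases hX : X x = 0
  · by_cases hY : Y x = 0
    · have hXY : lieBracket X Y x = 0 :=
        (congrFun VectorField.mlieBracketWithin_univ.symm x).trans
          (VectorField.mlieBracketWithin_eq_zero_of_eq_zero hX hY)
      rw [hXY, hX, hY, map_zero, map_zero, map_zero, sub_zero]
    · exact key Y hY
  · exact key X hX

theorem mvfderiv_lieBracket {f : M → W} (hf : ContMDiff 𝓘(ℝ, E) 𝓘(ℝ, W) ∞ f)
    (X Y : VField E M) (x : M) :
    mvfderiv 𝓘(ℝ, E) f x (lieBracket X Y x) =
      mvfderiv 𝓘(ℝ, E) (fun y ↦ mvfderiv 𝓘(ℝ, E) f y (Y y)) x (X x) -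
        mvfderiv 𝓘(ℝ, E) (fun y ↦ mvfderiv 𝓘(ℝ, E) f y (X y)) x (Y x) := by
  rw [← sub_eq_zero]
  refine SeparatingDual.eq_zero_of_forall_dual_eq_zero (R := ℝ) fun φ ↦ ?_
  have hd {h : M → W} (hh : ContMDiff 𝓘(ℝ, E) 𝓘(ℝ, W) ∞ h) (y : M) :=
    (hh y).mdifferentiableAt (by simp)
  have h := mvfderiv_lieBracket_real (φ.contMDiff.comp hf) X Y x
  simp only [Function.comp_def, mvfderiv_continuousLinearMap_comp φ (hd hf _),
    mvfderiv_continuousLinearMap_comp φ (hd (contMDiff_mvfderiv hf _) _)] at h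
  rw [map_sub, map_sub, h, sub_self]

end LieBracket

section MatrixInverse

variable {E : Type*} [NormedAddCommGroup E] [NormedSpace ℝ E]
  {M : Type*} [TopologicalSpace M] [ChartedSpace E M] {n : ℕ∞ω}
  {ι : Type*} [Fintype ι] [DecidableEq ι] {A : M → Matrix ι ι ℝ} {x₀ : M}

theorem contMDiffAt_matrix_det
    (hA : ∀ i j, ContMDiffAt 𝓘(ℝ, E) 𝓘(ℝ, ℝ) n (fun x ↦ A x i j) x₀) :
    ContMDiffAt 𝓘(ℝ, E) 𝓘(ℝ, ℝ) n (fun x ↦ (A x).det) x₀ := by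
  simp only [Matrix.det_apply']
  exact ContMDiffAt.sum fun σ _ ↦ contMDiffAt_const.mul
    (contMDiffAt_finsetProd fun i _ ↦ hA _ _)

theorem contMDiffAt_matrix_inv
    (hA : ∀ i j, ContMDiffAt 𝓘(ℝ, E) 𝓘(ℝ, ℝ) n (fun x ↦ A x i j) x₀) (h₀ : (A x₀).det ≠ 0)
    (i j : ι) : ContMDiffAt 𝓘(ℝ, E) 𝓘(ℝ, ℝ) n (fun x ↦ (A x)⁻¹ i j) x₀ := by
  simp only [Matrix.inv_def, Ring.inverse_eq_inv', Matrix.smul_apply, smul_eq_mul,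
    Matrix.adjugate_apply]
  refine ((contMDiffAt_matrix_det hA).inv₀ h₀).mul (contMDiffAt_matrix_det fun k l ↦ ?_)
  by_cases h : k = j
  · subst h
    simpa using contMDiffAt_const
  · simpa [Matrix.updateRow_ne h] using hA k l

end MatrixInverse

theorem bilinForm_apply_sum_toMatrix_inv_mulVec {K V ι : Type*} [Field K] [AddCommGroup V]
    [Module K V] [Fintype ι] [DecidableEq ι] (b : Module.Basis ι K V)
    {B : LinearMap.BilinForm K V} (hB : B.Nondegenerate) (ℓ : ι → K) (i : ι) :
    B (b i) (∑ j, ((LinearMap.BilinForm.toMatrix b B)⁻¹.mulVec ℓ) j • b j) = ℓ i := by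
  let G := LinearMap.BilinForm.toMatrix b B
  have hdet : IsUnit G.det :=
    ((LinearMap.BilinForm.nondegenerate_iff_det_ne_zero b).mp hB).isUnit
  have hG : G.mulVec (G⁻¹.mulVec ℓ) = ℓ := by
    rw [Matrix.mulVec_mulVec, Matrix.mul_nonsing_inv _ hdet, Matrix.one_mulVec]
  conv_rhs => rw [← hG]
  simp only [map_sum, map_smul, smul_eq_mul, Matrix.mulVec, dotProduct, G,
    LinearMap.BilinForm.toMatrix_apply, mul_comm]

section GlobalSections

open Filter Topology Module

variable {E : Type*} [NormedAddCommGroup E] [NormedSpace ℝ E]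
  {M : Type*} [TopologicalSpace M] [ChartedSpace E M]
  {F : Type*} [NormedAddCommGroup F] [NormedSpace ℝ F]
  {S : M → Type*} [TopologicalSpace (TotalSpace F S)]
  [∀ x, AddCommGroup (S x)] [∀ x, Module ℝ (S x)] [∀ x, TopologicalSpace (S x)]
  [FiberBundle F S] [VectorBundle ℝ F S]

theorem contMDiffSection_sum_apply {ι : Type*} (s : Finset ι) (e : ι → Cₛ^∞⟮𝓘(ℝ, E); F, S⟯)
    (x : M) : (∑ i ∈ s, e i) x = ∑ i ∈ s, e i x :=
  (congrFun (map_sum (ContMDiffSection.coeAddHom 𝓘(ℝ, E) F ∞ S) e s) x).trans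
    (Finset.sum_apply x s _)

theorem apply_eq_of_frame {L : Cₛ^∞⟮𝓘(ℝ, E); F, S⟯ →+ (M → ℝ)} {n : ℕ}
    {e : Fin n → Cₛ^∞⟮𝓘(ℝ, E); F, S⟯} {ψ : M → ℝ}
    (hψ : ContMDiff 𝓘(ℝ, E) 𝓘(ℝ, ℝ) ∞ ψ) {a : Fin n → M → ℝ}
    (ha : ∀ i, ContMDiff 𝓘(ℝ, E) 𝓘(ℝ, ℝ) ∞ (a i)) {η : Cₛ^∞⟮𝓘(ℝ, E); F, S⟯}
    (hη : ∀ x, ψ x • η x = ∑ i, a i x • e i x)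
    (hL : ∀ (f : M → ℝ) (hf : ContMDiff 𝓘(ℝ, E) 𝓘(ℝ, ℝ) ∞ f) η x,
      L (functionSMul f hf η) x = f x * L η x)
    {x : M} (hψx : ψ x = 1) {ℓ : S x →ₗ[ℝ] ℝ} (hℓ : ∀ i, ℓ (e i x) = L (e i) x) :
    ℓ (η x) = L η x := by
  have hψη : functionSMul ψ hψ η = ∑ i, functionSMul (a i) (ha i) (e i) := by
    ext y
    rw [contMDiffSection_sum_apply]
    exact hη y
  have hηx : η x = ∑ i, a i x • e i x := by rw [← hη x, hψx, one_smul]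
  have hLη : L η x = ∑ i, a i x * L (e i) x := by
    simpa only [map_sum, Finset.sum_apply, hL, hψx, one_mul] using congrFun (congrArg L hψη) x
  simp only [hηx, hLη, map_sum, map_smul, hℓ, smul_eq_mul]

variable [FiniteDimensional ℝ E] [IsManifold 𝓘(ℝ, E) ∞ M] [T2Space M] [FiniteDimensional ℝ F]
  [ContMDiffVectorBundle ∞ F S 𝓘(ℝ, E)]

theorem exists_global_frame_near (x₀ : M) :
    ∃ (e : Fin (finrank ℝ F) → Cₛ^∞⟮𝓘(ℝ, E); F, S⟯) (ψ : M → ℝ),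
      (∀ᶠ x in 𝓝 x₀, ψ x = 1 ∧ ∃ b : Basis (Fin (finrank ℝ F)) ℝ (S x), ∀ i, b i = e i x) ∧
      ContMDiff 𝓘(ℝ, E) 𝓘(ℝ, ℝ) ∞ ψ ∧
      ∀ η : Cₛ^∞⟮𝓘(ℝ, E); F, S⟯, ∃ a : Fin (finrank ℝ F) → M → ℝ,
        (∀ i, ContMDiff 𝓘(ℝ, E) 𝓘(ℝ, ℝ) ∞ (a i)) ∧ ∀ x, ψ x • η x = ∑ i, a i x • e i x := by
  have : ContMDiffVectorBundle 1 F S 𝓘(ℝ, E) :=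
    ContMDiffVectorBundle.of_le (n := ∞) ENat.LEInfty.out
  let t := trivializationAt F S x₀
  let b := finBasis ℝ F
  have ht : t.baseSet ∈ 𝓝 x₀ :=
    t.open_baseSet.mem_nhds (FiberBundle.mem_baseSet_trivializationAt' x₀)
  obtain ⟨f, -, hf⟩ := (SmoothBumpFunction.nhds_basis_tsupport (I := 𝓘(ℝ, E)) x₀).mem_iff.mp ht
  have hfs : ContMDiff 𝓘(ℝ, E) 𝓘(ℝ, ℝ) ∞ f := f.contMDiff
  let e (i : Fin (finrank ℝ F)) : Cₛ^∞⟮𝓘(ℝ, E); F, S⟯ :=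
    ⟨⇑f • t.localFrame b i, hfs.contMDiffOn.smul_section_of_tsupport t.open_baseSet hf
      (t.contMDiffOn_localFrame_baseSet ∞ b i)⟩
  have he (i x) : e i x = f x • t.localFrame b i x := rfl
  -- One factor of the bump function extends the frame, the other the coefficients of `η`.
  refine ⟨e, fun x ↦ f x * f x, ?_, hfs.mul hfs, fun η ↦ ⟨fun i x ↦
    f x * t.localFrameCoeff 𝓘(ℝ, E) b i x (η x), fun i ↦ ?_, fun x ↦ ?_⟩⟩
  · filter_upwards [f.eventuallyEq_one, ht] with x hfx hx
    have hfr := t.isLocalFrameOn_localFrame_baseSet 𝓘(ℝ, E) ∞ b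
    refine ⟨by simp [hfx], hfr.toBasisAt hx, fun i ↦ ?_⟩
    rw [hfr.toBasisAt_coe, he, hfx, Pi.one_apply, one_smul]
  · refine contMDiff_of_tsupport fun x hx ↦ ?_
    have hxb : x ∈ t.baseSet := hf (closure_mono (Function.support_mul_subset_left _ _) hx)
    exact (hfs x).mul (contMDiffAt_localFrameCoeff b hxb (η.contMDiff x) i)
  · by_cases hx : x ∈ t.baseSet
    · conv_lhs => rw [t.eq_sum_localFrameCoeff_smul (I := 𝓘(ℝ, E)) (b := b) (s := η) hx]
      simp only [Finset.smul_sum, he, smul_smul, mul_right_comm]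
    · have hfx : f x = 0 := by_contra fun h ↦ hx (hf (subset_tsupport f h))
      simp only [hfx, zero_mul, zero_smul, Finset.sum_const_zero]

theorem exists_contMDiffSection_apply_eq (x : M) (v : S x) :
    ∃ η : Cₛ^∞⟮𝓘(ℝ, E); F, S⟯, η x = v := by
  obtain ⟨e, ψ, he, -⟩ := exists_global_frame_near (E := E) (F := F) (S := S) x
  obtain ⟨-, b, hb⟩ := he.self_of_nhds
  refine ⟨∑ i, b.repr v i • e i, ?_⟩
  rw [contMDiffSection_sum_apply]
  simp only [ContMDiffSection.coe_smul, Pi.smul_apply, ← hb, b.sum_repr]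

variable {B : ∀ x : M, LinearMap.BilinForm ℝ (S x)} {L : Cₛ^∞⟮𝓘(ℝ, E); F, S⟯ →+ (M → ℝ)}

theorem exists_local_section_representing (hB : ∀ x, (B x).Nondegenerate)
    (hBs : ∀ η ξ : Cₛ^∞⟮𝓘(ℝ, E); F, S⟯, ContMDiff 𝓘(ℝ, E) 𝓘(ℝ, ℝ) ∞ fun x ↦ B x (η x) (ξ x))
    (hLs : ∀ η, ContMDiff 𝓘(ℝ, E) 𝓘(ℝ, ℝ) ∞ (L η))
    (hL : ∀ (f : M → ℝ) (hf : ContMDiff 𝓘(ℝ, E) 𝓘(ℝ, ℝ) ∞ f) η x,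
      L (functionSMul f hf η) x = f x * L η x) (x₀ : M) :
    ∃ ζ : ∀ x, S x,
      ContMDiffAt 𝓘(ℝ, E) (𝓘(ℝ, E).prod 𝓘(ℝ, F)) ∞ (fun x ↦ TotalSpace.mk' F x (ζ x)) x₀ ∧
      ∀ᶠ x in 𝓝 x₀, ∀ η : Cₛ^∞⟮𝓘(ℝ, E); F, S⟯, B x (η x) (ζ x) = L η x := by
  obtain ⟨e, ψ, he, hψ, hcoeff⟩ := exists_global_frame_near (E := E) (F := F) (S := S) x₀
  let G (x : M) : Matrix (Fin (finrank ℝ F)) (Fin (finrank ℝ F)) ℝ :=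
    Matrix.of fun i j ↦ B x (e i x) (e j x)
  have hG {x : M} {b : Basis (Fin (finrank ℝ F)) ℝ (S x)} (hb : ∀ i, b i = e i x) :
      G x = LinearMap.BilinForm.toMatrix b (B x) := by
    ext i j
    simp only [G, Matrix.of_apply, LinearMap.BilinForm.toMatrix_apply, hb]
  let c (x : M) : Fin (finrank ℝ F) → ℝ := (G x)⁻¹.mulVec fun k ↦ L (e k) x
  have hc (j) : ContMDiffAt 𝓘(ℝ, E) 𝓘(ℝ, ℝ) ∞ (fun x ↦ c x j) x₀ := by
    obtain ⟨-, b, hb⟩ := he.self_of_nhds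
    have hdet : (G x₀).det ≠ 0 := by
      rw [hG hb]
      exact (LinearMap.BilinForm.nondegenerate_iff_det_ne_zero b).mp (hB x₀)
    change ContMDiffAt 𝓘(ℝ, E) 𝓘(ℝ, ℝ) ∞ (fun x ↦ ∑ k, (G x)⁻¹ j k * L (e k) x) x₀
    exact ContMDiffAt.sum fun k _ ↦
      (contMDiffAt_matrix_inv (A := G) (fun i l ↦ hBs (e i) (e l) x₀) hdet j k).mul (hLs _ x₀)
  refine ⟨fun x ↦ ∑ j, c x j • e j x, ContMDiffAt.sum_section fun j _ ↦
    (hc j).smul_section ((e j).contMDiff x₀), ?_⟩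
  filter_upwards [he] with x ⟨hψx, b, hb⟩ η
  obtain ⟨a, ha, hη⟩ := hcoeff η
  refine apply_eq_of_frame hψ ha hη hL hψx (ℓ := (B x).flip _) fun i ↦ ?_
  have h := bilinForm_apply_sum_toMatrix_inv_mulVec b (hB x) (fun k ↦ L (e k) x) i
  simp only [← hG hb, hb] at h
  exact h

theorem exists_section_representing (hB : ∀ x, (B x).Nondegenerate)
    (hBs : ∀ η ξ : Cₛ^∞⟮𝓘(ℝ, E); F, S⟯, ContMDiff 𝓘(ℝ, E) 𝓘(ℝ, ℝ) ∞ fun x ↦ B x (η x) (ξ x))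
    (hLs : ∀ η, ContMDiff 𝓘(ℝ, E) 𝓘(ℝ, ℝ) ∞ (L η))
    (hL : ∀ (f : M → ℝ) (hf : ContMDiff 𝓘(ℝ, E) 𝓘(ℝ, ℝ) ∞ f) η x,
      L (functionSMul f hf η) x = f x * L η x) :
    ∃ ζ : Cₛ^∞⟮𝓘(ℝ, E); F, S⟯, ∀ η x, B x (η x) (ζ x) = L η x := by
  choose Z hZs hZ using exists_local_section_representing hB hBs hLs hL
  refine ⟨⟨fun x ↦ Z x x, fun x₀ ↦ (hZs x₀).congr_of_eventuallyEq ?_⟩,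
    fun η x ↦ (hZ x).self_of_nhds η⟩
  filter_upwards [hZ x₀] with x hx
  congr 1
  rw [← sub_eq_zero]
  refine (hB x).2 _ fun v ↦ ?_
  obtain ⟨η, rfl⟩ := exists_contMDiffSection_apply_eq (E := E) (F := F) x v
  rw [map_sub, (hZ x).self_of_nhds η, hx η, sub_self]

end GlobalSections

section Tensors

variable {E : Type*} [NormedAddCommGroup E] [NormedSpace ℝ E]
  {M : Type*} [TopologicalSpace M] [ChartedSpace E M] [IsManifold 𝓘(ℝ, E) ∞ M]
  {F : Type*} [NormedAddCommGroup F] [NormedSpace ℝ F]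
  {S : M → Type*} [TopologicalSpace (TotalSpace F S)]
  [∀ x, AddCommGroup (S x)] [∀ x, Module ℝ (S x)] [∀ x, TopologicalSpace (S x)]
  [FiberBundle F S] [VectorBundle ℝ F S]

local notation "𝔛" => VField E M
local notation "Γ" => Cₛ^∞⟮𝓘(ℝ, E); F, S⟯

section Alternation

open Equiv

variable {j k : ℕ}

/-- The tensor `X ↦ Φ (X ∘ τ)` with permuted arguments. -/
def EndTensor.permute (Φ : EndTensor E F S k) (τ : Perm (Fin k)) : EndTensor E F S k :=
  fun X ↦ Φ (X ∘ τ)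

theorem alt_eq_sum_permute (Φ : EndTensor E F S k) :
    alt Φ = (k.factorial : ℝ)⁻¹ • ∑ σ : Perm (Fin k), (Perm.sign σ : ℤ) • Φ.permute σ := by
  funext X ξ
  simp only [alt, EndTensor.permute, Pi.smul_apply, Finset.sum_apply]

theorem alt_add (Φ Ψ : EndTensor E F S k) : alt (Φ + Ψ) = alt Φ + alt Ψ := by
  funext X ξ
  simp only [alt, Pi.add_apply, smul_add, Finset.sum_add_distrib]

theorem alt_smul (c : ℝ) (Φ : EndTensor E F S k) : alt (c • Φ) = c • alt Φ := by
  funext X ξ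
  simp only [alt, Pi.smul_apply, Finset.smul_sum, smul_comm _ c]

variable (E F S k) in
/-- Skew symmetrization as a linear map. -/
def altLinearMap : EndTensor E F S k →ₗ[ℝ] EndTensor E F S k where
  toFun := alt
  map_add' := alt_add
  map_smul' := alt_smul

theorem alt_permute (Φ : EndTensor E F S k) (τ : Perm (Fin k)) :
    alt (Φ.permute τ) = (Perm.sign τ : ℤ) • alt Φ := by
  simp only [alt_eq_sum_permute, smul_comm (Perm.sign τ : ℤ), Finset.smul_sum]
  rw [← Equiv.sum_comp (Equiv.mulRight τ) fun σ ↦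
    (k.factorial : ℝ)⁻¹ • (Perm.sign σ : ℤ) • (Perm.sign τ : ℤ) • Φ.permute σ]
  refine Finset.sum_congr rfl fun σ _ ↦ ?_
  have hsign : (Perm.sign (σ * τ) : ℤ) * Perm.sign τ = Perm.sign σ := by
    rw [Perm.sign_mul, Units.val_mul, mul_assoc, ← Units.val_mul, Int.units_mul_self,
      Units.val_one, mul_one]
  rw [smul_smul (Perm.sign _ : ℤ), Equiv.coe_mulRight, hsign]
  rfl

theorem two_smul_alt_of_sign_eq_neg_one (Φ : EndTensor E F S k) {τ : Perm (Fin k)}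
    (hτ : Perm.sign τ = -1) : (2 : ℝ) • alt Φ = alt (Φ - Φ.permute τ) := by
  change _ = altLinearMap E F S k (Φ - Φ.permute τ)
  rw [map_sub, two_smul]
  simp [altLinearMap, alt_permute, hτ]

theorem alt_eq_zero_of_cyclic {Φ : EndTensor E F S k} {τ : Perm (Fin k)}
    (hτ : Perm.sign τ = 1) (h : Φ + Φ.permute τ + Φ.permute (τ * τ) = 0) : alt Φ = 0 := by
  have h₃ : (3 : ℝ) • alt Φ = alt (Φ + Φ.permute τ + Φ.permute (τ * τ)) := by
    simp only [alt_add, alt_permute, Perm.sign_mul, hτ, mul_one, Units.val_one, one_smul]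
    module
  rw [h] at h₃
  exact (smul_eq_zero.mp (h₃.trans (map_zero (altLinearMap E F S k)))).resolve_left (by norm_num)

/-- Normalized skew symmetrization in the slots of a tensor that are singled out by `f`. -/
def partialAlt (f : Fin j ↪ Fin k) (Φ : EndTensor E F S k) : EndTensor E F S k :=
  (j.factorial : ℝ)⁻¹ • ∑ σ : Perm (Fin j),
    (Perm.sign σ : ℤ) • Φ.permute (σ.viaFintypeEmbedding f)

theorem alt_partialAlt (f : Fin j ↪ Fin k) (Φ : EndTensor E F S k) :
    alt (partialAlt f Φ) = alt Φ := by
  have hσ (σ : Perm (Fin j)) :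
      altLinearMap E F S k ((Perm.sign σ : ℤ) • Φ.permute (σ.viaFintypeEmbedding f)) = alt Φ := by
    rw [map_zsmul]
    change (Perm.sign σ : ℤ) • alt (Φ.permute _) = _
    rw [alt_permute, Perm.viaFintypeEmbedding_sign, smul_smul, ← Units.val_mul,
      Int.units_mul_self, Units.val_one, one_smul]
  change altLinearMap E F S k (partialAlt f Φ) = _
  rw [partialAlt, map_smul, map_sum, Finset.sum_congr rfl fun σ _ ↦ hσ σ, Finset.sum_const,
    Finset.card_univ, Fintype.card_perm, Fintype.card_fin, ← Nat.cast_smul_eq_nsmul ℝ,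
    inv_smul_smul₀ (Nat.cast_ne_zero.mpr j.factorial_ne_zero)]

theorem comp_viaFintypeEmbedding_comp {α : Type*} (f : Fin j ↪ Fin k) (σ : Perm (Fin j))
    (W : Fin k → α) : (W ∘ σ.viaFintypeEmbedding f) ∘ f = (W ∘ f) ∘ σ :=
  funext fun i ↦ congrArg W (σ.viaFintypeEmbedding_apply_image f i)

theorem comp_viaFintypeEmbedding_apply {α : Type*} (f : Fin j ↪ Fin k) (σ : Perm (Fin j))
    (W : Fin k → α) {b : Fin k} (hb : b ∉ Set.range f) :
    (W ∘ σ.viaFintypeEmbedding f) b = W b :=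
  congrArg W (σ.viaFintypeEmbedding_apply_notMem_range f hb)

end Alternation

section FormalConnections

open Equiv

variable {j k : ℕ} (N : VField E M →+ VField E M →+ VField E M)
  (D D' : VField E M →+ Cₛ^∞⟮𝓘(ℝ, E); F, S⟯ →+ Cₛ^∞⟮𝓘(ℝ, E); F, S⟯)

/-- The action of `A : 𝔛 → 𝔛` on the arguments of a tensor as a derivation,
`(X₁, …, X_k) ↦ ∑ᵢ Φ(X₁, …, A Xᵢ, …, X_k)`. -/
def derivExt (A : 𝔛 → 𝔛) (Φ : EndTensor E F S k) : EndTensor E F S k :=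
  fun X ξ ↦ ∑ i, Φ (Function.update X i (A (X i))) ξ

theorem derivExt_permute (A : 𝔛 → 𝔛) (Φ : EndTensor E F S k) (σ : Perm (Fin k)) :
    derivExt A (Φ.permute σ) = (derivExt A Φ).permute σ := by
  funext X ξ
  refine (Equiv.sum_comp σ _).symm.trans (Finset.sum_congr rfl fun i _ ↦ ?_)
  simp only [EndTensor.permute, Function.update_comp_equiv, Equiv.symm_apply_apply,
    Function.comp_apply]

theorem derivExt_alt (A : 𝔛 → 𝔛) (Φ : EndTensor E F S k) :
    derivExt A (alt Φ) = alt (derivExt A Φ) := by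
  simp only [alt_eq_sum_permute, ← derivExt_permute]
  funext X ξ
  simp only [derivExt, Pi.smul_apply, Finset.sum_apply, ← Finset.smul_sum]
  rw [Finset.sum_comm]
  simp only [Finset.smul_sum]

theorem inducedD_apply (Φ : EndTensor E F S k) (W : Fin (k + 1) → 𝔛) (ξ : Γ) :
    inducedD (N · ·) (D · ·) (D' · ·) Φ W ξ =
      D (W 0) (Φ (Fin.tail W) ξ) - derivExt (N (W 0)) Φ (Fin.tail W) ξ -
        Φ (Fin.tail W) (D' (W 0) ξ) := rfl

theorem inducedD_alt (Φ : EndTensor E F S k) :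
    inducedD (N · ·) (D · ·) (D' · ·) (alt Φ) =
      partialAlt (Fin.succEmb k) (inducedD (N · ·) (D · ·) (D' · ·) Φ) := by
  funext W ξ
  have h₀ (σ : Perm (Fin k)) : (W ∘ σ.viaFintypeEmbedding (Fin.succEmb k)) 0 = W 0 :=
    comp_viaFintypeEmbedding_apply _ σ W fun ⟨i, hi⟩ ↦ Fin.succ_ne_zero i hi
  have htail (σ : Perm (Fin k)) :
      Fin.tail (W ∘ σ.viaFintypeEmbedding (Fin.succEmb k)) = Fin.tail W ∘ σ :=
    comp_viaFintypeEmbedding_comp (Fin.succEmb k) σ W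
  rw [inducedD_apply, derivExt_alt]
  simp only [partialAlt, alt, EndTensor.permute, Pi.smul_apply, Finset.sum_apply, inducedD_apply,
    h₀, htail, map_inv_natCast_smul _ ℝ ℝ, map_sum, map_zsmul, ← smul_sub,
    ← Finset.sum_sub_distrib]

/-- The commutator `A Φ - Φ A'`, as the tensor
`A(W₁, …, W_j) Φ(W_{j+1}, …, W_{j+k}) - Φ(W_{j+1}, …, W_{j+k}) A'(W₁, …, W_j)`. -/
def comm (A A' : EndTensor E F S j) (Φ : EndTensor E F S k) : EndTensor E F S (k + j) := fun W ξ ↦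
  A (W ∘ Fin.castLEEmb (Nat.le_add_left j k)) (Φ (W ∘ Fin.addNatEmb j) ξ) -
    Φ (W ∘ Fin.addNatEmb j) (A' (W ∘ Fin.castLEEmb (Nat.le_add_left j k)) ξ)

theorem addNatEmb_notMem_range_castLEEmb (i : Fin k) :
    Fin.addNatEmb j i ∉ Set.range (Fin.castLEEmb (Nat.le_add_left j k)) := by
  rintro ⟨l, hl⟩
  have : (l : ℕ) = i + j := congrArg Fin.val hl
  omega

theorem castLEEmb_notMem_range_addNatEmb (i : Fin j) :
    Fin.castLEEmb (Nat.le_add_left j k) i ∉ Set.range (Fin.addNatEmb j) := by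
  rintro ⟨l, hl⟩
  have : (l : ℕ) + j = i := congrArg Fin.val hl
  omega

theorem comm_alt_left (A A' : EndTensor E F S j) (Φ : (Fin k → 𝔛) → Γ →+ Γ) :
    comm (alt A) (alt A') (Φ · ·) =
      partialAlt (Fin.castLEEmb (Nat.le_add_left j k)) (comm A A' (Φ · ·)) := by
  funext W ξ
  have hW (σ : Perm (Fin j)) :
      (W ∘ σ.viaFintypeEmbedding (Fin.castLEEmb (Nat.le_add_left j k))) ∘ Fin.addNatEmb j =
        W ∘ Fin.addNatEmb j :=
    funext fun i ↦ comp_viaFintypeEmbedding_apply _ σ W (addNatEmb_notMem_range_castLEEmb i)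
  simp only [comm, partialAlt, alt, EndTensor.permute, Pi.smul_apply, Finset.sum_apply, hW,
    comp_viaFintypeEmbedding_comp, map_inv_natCast_smul _ ℝ ℝ, map_sum, map_zsmul,
    ← smul_sub, ← Finset.sum_sub_distrib]

theorem comm_alt_right (A A' : (Fin j → 𝔛) → Γ →+ Γ) (Φ : EndTensor E F S k) :
    comm (A · ·) (A' · ·) (alt Φ) =
      partialAlt (Fin.addNatEmb j) (comm (A · ·) (A' · ·) Φ) := by
  funext W ξ
  have hW (σ : Perm (Fin k)) :
      (W ∘ σ.viaFintypeEmbedding (Fin.addNatEmb j)) ∘ Fin.castLEEmb (Nat.le_add_left j k) =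
        W ∘ Fin.castLEEmb (Nat.le_add_left j k) :=
    funext fun i ↦ comp_viaFintypeEmbedding_apply _ σ W (castLEEmb_notMem_range_addNatEmb i)
  simp only [comm, partialAlt, alt, EndTensor.permute, Pi.smul_apply, Finset.sum_apply, hW,
    comp_viaFintypeEmbedding_comp, map_inv_natCast_smul _ ℝ ℝ, map_sum, map_zsmul,
    ← smul_sub, ← Finset.sum_sub_distrib]

theorem comm_add_right (A A' : (Fin j → 𝔛) → Γ →+ Γ) (Φ Ψ : EndTensor E F S k) :
    comm (A · ·) (A' · ·) (Φ + Ψ) = comm (A · ·) (A' · ·) Φ + comm (A · ·) (A' · ·) Ψ := by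
  funext W ξ
  simp only [comm, Pi.add_apply, map_add]
  abel

end FormalConnections

section Commutators

variable {j k : ℕ} (N : VField E M →+ VField E M →+ VField E M)
  (D D' : VField E M →+ Cₛ^∞⟮𝓘(ℝ, E); F, S⟯ →+ Cₛ^∞⟮𝓘(ℝ, E); F, S⟯)

theorem sum_univ_castLE_add_sum_univ_addNat {α : Type*} [AddCommMonoid α] (f : Fin (k + j) → α) :
    ∑ i, f i = ∑ i : Fin j, f (Fin.castLEEmb (Nat.le_add_left j k) i) +
      ∑ i : Fin k, f (Fin.addNatEmb j i) := by
  rw [← Equiv.sum_comp (finCongr (Nat.add_comm j k)), Fin.sum_univ_add]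
  congr 1
  exact Finset.sum_congr rfl fun i _ ↦ congrArg f (Fin.ext (Nat.add_comm j i))

theorem derivExt_comm (A : 𝔛 → 𝔛) (R : (Fin j → 𝔛) → Γ →+ Γ) (R' : EndTensor E F S j)
    (Φ : (Fin k → 𝔛) → Γ →+ Γ) :
    derivExt A (comm (R · ·) R' (Φ · ·)) =
      comm (derivExt A (R · ·)) (derivExt A R') (Φ · ·) +
        comm (R · ·) R' (derivExt A (Φ · ·)) := by
  funext W ξ
  refine (sum_univ_castLE_add_sum_univ_addNat _).trans (congrArg₂ _ ?_ ?_)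
  · simp only [comm, derivExt, map_sum, ← Finset.sum_sub_distrib,
      Function.update_comp_eq_of_injective _ (Function.Embedding.injective _),
      Function.update_comp_eq_of_notMem_range _ _ (castLEEmb_notMem_range_addNatEmb _),
      Function.comp_apply]
  · simp only [comm, derivExt, map_sum, ← Finset.sum_sub_distrib,
      Function.update_comp_eq_of_injective _ (Function.Embedding.injective _),
      Function.update_comp_eq_of_notMem_range _ _ (addNatEmb_notMem_range_castLEEmb _),
      Function.comp_apply]

theorem inducedD_comm (R R' : (Fin 2 → 𝔛) → Γ →+ Γ) (Φ : (Fin k → 𝔛) → Γ →+ Γ) :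
    inducedD (N · ·) (D · ·) (D' · ·) (comm (R · ·) (R' · ·) (Φ · ·)) =
      comm (inducedD (N · ·) (D · ·) (D · ·) (R · ·))
          (inducedD (N · ·) (D' · ·) (D' · ·) (R' · ·)) (Φ · ·) +
        (comm (R · ·) (R' · ·) (inducedD (N · ·) (D · ·) (D' · ·) (Φ · ·))).permute
          ((finRotate 3).viaFintypeEmbedding (Fin.castLEEmb (Nat.le_add_left 3 k))) := by
  funext W ξ
  set τ := (finRotate 3).viaFintypeEmbedding (Fin.castLEEmb (Nat.le_add_left 3 k))
  have hτ (i : Fin 3) : (W ∘ τ) (Fin.castLE (Nat.le_add_left 3 k) i) =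
      W (Fin.castLE (Nat.le_add_left 3 k) (finRotate 3 i)) :=
    congrFun (comp_viaFintypeEmbedding_comp _ (finRotate 3) W) i
  have hR : (W ∘ τ) ∘ Fin.castLEEmb (Nat.le_add_left 2 (k + 1)) =
      Fin.tail W ∘ Fin.castLEEmb (Nat.le_add_left 2 k) := by
    funext i
    fin_cases i
    exacts [hτ 0, hτ 1]
  have h₀ : ((W ∘ τ) ∘ Fin.addNatEmb 2) 0 = W 0 := hτ 2
  have hΦ : Fin.tail ((W ∘ τ) ∘ Fin.addNatEmb 2) = Fin.tail W ∘ Fin.addNatEmb 2 := by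
    funext i
    refine comp_viaFintypeEmbedding_apply _ _ W ?_
    exact addNatEmb_notMem_range_castLEEmb (j := 3) i
  have h₀' : (W ∘ Fin.castLEEmb (Nat.le_add_left (2 + 1) k)) 0 = W 0 := rfl
  have hR' : Fin.tail (W ∘ Fin.castLEEmb (Nat.le_add_left (2 + 1) k)) =
      Fin.tail W ∘ Fin.castLEEmb (Nat.le_add_left 2 k) := rfl
  have hΦ' : W ∘ Fin.addNatEmb (2 + 1) = Fin.tail W ∘ Fin.addNatEmb 2 := rfl
  rw [inducedD_apply, derivExt_comm]
  simp only [Pi.add_apply, EndTensor.permute, comm, inducedD_apply, hR, h₀, hΦ, h₀', hR', hΦ',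
    map_sub]
  abel

theorem inducedD_add (Φ Ψ : EndTensor E F S k) :
    inducedD (N · ·) (D · ·) (D' · ·) (Φ + Ψ) =
      inducedD (N · ·) (D · ·) (D' · ·) Φ + inducedD (N · ·) (D · ·) (D' · ·) Ψ := by
  funext W ξ
  simp only [inducedD, Pi.add_apply, map_add, Finset.sum_add_distrib]
  abel

theorem derivExt_sub (A B : 𝔛 → 𝔛) (Φ : MultilinearMap ℤ (fun _ : Fin k ↦ 𝔛) (Γ →+ Γ)) :
    derivExt (A - B) (Φ · ·) = derivExt A (Φ · ·) - derivExt B (Φ · ·) := by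
  funext X ξ
  simp only [derivExt, Pi.sub_apply, Φ.map_update_sub, AddMonoidHom.sub_apply,
    Finset.sum_sub_distrib]

theorem derivExt_derivExt_sub (A B : 𝔛 → 𝔛)
    (Φ : MultilinearMap ℤ (fun _ : Fin k ↦ 𝔛) (Γ →+ Γ)) :
    derivExt A (derivExt B (Φ · ·)) - derivExt B (derivExt A (Φ · ·)) =
      derivExt (B ∘ A - A ∘ B) (Φ · ·) := by
  funext X ξ
  let f (A B : 𝔛 → 𝔛) (i l : Fin k) : Γ :=
    let V := Function.update X i (A (X i))
    Φ (Function.update V l (B (V l))) ξ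
  have hdiag (A B : 𝔛 → 𝔛) (i : Fin k) : f A B i i = Φ (Function.update X i (B (A (X i)))) ξ := by
    simp only [f, Function.update_self, Function.update_idem]
  have hswap {i l : Fin k} (h : l ≠ i) : f A B i l = f B A l i := by
    simp only [f, Function.update_of_ne h, Function.update_of_ne h.symm, Function.update_comm h]
  change ∑ i, ∑ l, f A B i l - ∑ i, ∑ l, f B A i l = _
  rw [Finset.sum_comm (f := f B A), ← Finset.sum_sub_distrib]
  refine Finset.sum_congr rfl fun i _ ↦ ?_
  rw [← Finset.sum_sub_distrib, Fintype.sum_eq_single i fun l hl ↦ sub_eq_zero.mpr (hswap hl),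
    hdiag, hdiag]
  exact (DFunLike.congr_fun (Φ.map_update_sub X i _ _) ξ).symm

theorem derivExt_inducedD (A : 𝔛 → 𝔛) (Φ : EndTensor E F S k) (U : Fin (k + 1) → 𝔛) (ξ : Γ) :
    derivExt A (inducedD (N · ·) (D · ·) (D' · ·) Φ) U ξ =
      inducedD (N · ·) (D · ·) (D' · ·) Φ (Function.update U 0 (A (U 0))) ξ +
        (D (U 0) (derivExt A Φ (Fin.tail U) ξ) - derivExt A (derivExt (N (U 0)) Φ) (Fin.tail U) ξ -
          derivExt A Φ (Fin.tail U) (D' (U 0) ξ)) := by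
  refine (Fin.sum_univ_succ _).trans (congrArg _ ?_)
  have h₀ (i : Fin k) (V : 𝔛) : Function.update U i.succ V 0 = U 0 :=
    Function.update_of_ne (Fin.succ_ne_zero i).symm _ _
  simp only [inducedD_apply, Fin.tail_update_succ, h₀, Finset.sum_sub_distrib, derivExt, map_sum]
  rfl

theorem inducedD_inducedD_apply (Φ : MultilinearMap ℤ (fun _ : Fin k ↦ 𝔛) (Γ →+ Γ))
    (W : Fin (k + 2) → 𝔛) (ξ : Γ) :
    let X := W 0
    let Y := W 1
    let V := W ∘ Fin.addNatEmb 2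
    inducedD (N · ·) (D · ·) (D' · ·) (inducedD (N · ·) (D · ·) (D' · ·) (Φ · ·)) W ξ =
      D X (D Y (Φ V ξ)) - D (N X Y) (Φ V ξ) - D X (Φ V (D' Y ξ)) - D Y (Φ V (D' X ξ)) +
        Φ V (D' (N X Y) ξ) + Φ V (D' Y (D' X ξ)) -
        (D X (derivExt (N Y) (Φ · ·) V ξ) + D Y (derivExt (N X) (Φ · ·) V ξ)) +
        (derivExt (N X) (Φ · ·) V (D' Y ξ) + derivExt (N Y) (Φ · ·) V (D' X ξ)) +
        derivExt (N (N X Y)) (Φ · ·) V ξ +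
        derivExt (N X) (derivExt (N Y) (Φ · ·)) V ξ := by
  intro X Y V
  have hX : Fin.tail W 0 = Y := rfl
  have hV : Fin.tail (Fin.tail W) = V := rfl
  rw [inducedD_apply, derivExt_inducedD]
  simp only [inducedD_apply, Fin.tail_update_zero, Function.update_self, hX, hV, map_sub]
  abel

end Commutators

section TorsionFree

open Equiv

variable [FiniteDimensional ℝ E] {k : ℕ} {N : VField E M →+ VField E M →+ VField E M}
  {D D' : VField E M →+ Cₛ^∞⟮𝓘(ℝ, E); F, S⟯ →+ Cₛ^∞⟮𝓘(ℝ, E); F, S⟯}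

/-- The connection `N` on vector fields has no torsion. -/
def IsTorsionFree (N : VField E M →+ VField E M →+ VField E M) : Prop :=
  ∀ X Y, lieBracket X Y = N X Y - N Y X

/-- The curvature of a biadditive `D` as a tensor with additive values. -/
def curvatureHom (D : 𝔛 →+ Γ →+ Γ) (X : Fin 2 → 𝔛) : Γ →+ Γ :=
  (D (X 0)).comp (D (X 1)) - (D (X 1)).comp (D (X 0)) - D (lieBracket (X 0) (X 1))

theorem curvature_eq_curvatureHom (D : 𝔛 →+ Γ →+ Γ) :
    curvature (D · ·) = (curvatureHom D · ·) := rfl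

theorem IsTorsionFree.curvature_cyclic (hN : IsTorsionFree N) (X Y Z : 𝔛) :
    curvatureHom N ![X, Y] Z + curvatureHom N ![Y, Z] X + curvatureHom N ![Z, X] Y = 0 := by
  have hJ := lieBracket_jacobi X Y Z
  simp only [hN _ _, curvatureHom, map_sub, AddMonoidHom.sub_apply, AddMonoidHom.comp_apply,
    Matrix.cons_val] at hJ ⊢
  rw [← sub_eq_zero] at hJ
  rw [← hJ]
  abel

theorem IsTorsionFree.alt_inducedD_curvature (hN : IsTorsionFree N) :
    alt (inducedD (N · ·) (D · ·) (D · ·) (curvature (D · ·))) = 0 := by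
  refine alt_eq_zero_of_cyclic (τ := finRotate 3) (by decide) (funext₂ fun W ξ ↦ ?_)
  have hJ := congrArg (D · ξ) (lieBracket_jacobi (W 0) (W 1) (W 2))
  have h₀ : finRotate 3 0 = 1 := rfl
  have h₁ : finRotate 3 1 = 2 := rfl
  have h₂ : finRotate 3 2 = 0 := rfl
  simp only [EndTensor.permute, Pi.add_apply, Pi.zero_apply, inducedD, curvature, Fin.sum_univ_two,
    Fin.succ_zero_eq_one, Fin.succ_one_eq_two, Function.update_self, Function.update_of_ne,
    ne_eq, zero_ne_one, one_ne_zero, not_false_eq_true, Function.comp_apply, Perm.mul_apply,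
    h₀, h₁, h₂, hN _ _, map_sub, map_add, AddMonoidHom.sub_apply, AddMonoidHom.add_apply] at hJ ⊢
  rw [← sub_eq_zero] at hJ
  rw [← neg_eq_zero, ← hJ]
  abel

theorem IsTorsionFree.inducedD_inducedD_sub_permute (hN : IsTorsionFree N)
    (Φ : MultilinearMap ℤ (fun _ : Fin k ↦ 𝔛) (Γ →+ Γ)) :
    let D₂Φ := inducedD (N · ·) (D · ·) (D' · ·) (inducedD (N · ·) (D · ·) (D' · ·) (Φ · ·))
    D₂Φ - D₂Φ.permute (swap 0 1) =
      comm (curvature (D · ·)) (curvature (D' · ·)) (Φ · ·) -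
        fun W ↦ derivExt (curvatureHom N ![W 0, W 1]) (Φ · ·) (W ∘ Fin.addNatEmb 2) := by
  intro D₂Φ
  funext W ξ
  let X := W 0
  let Y := W 1
  let V := W ∘ Fin.addNatEmb 2
  have h₀ : (W ∘ swap 0 1) 0 = Y := congrArg W (swap_apply_left 0 1)
  have h₁ : (W ∘ swap 0 1) 1 = X := congrArg W (swap_apply_right 0 1)
  have hV : (W ∘ swap 0 1) ∘ Fin.addNatEmb 2 = V := by
    funext i
    refine congrArg W (swap_apply_of_ne_of_ne ?_ ?_) <;> simp [Fin.ext_iff]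
  have hcurv : (curvatureHom N ![X, Y] : 𝔛 → 𝔛) =
      (N X ∘ N Y - N Y ∘ N X) - (N (N X Y) - N (N Y X)) := by
    funext Z
    simp [curvatureHom, hN X Y]
  have hK : derivExt (curvatureHom N ![X, Y]) (Φ · ·) V ξ =
      derivExt (N Y) (derivExt (N X) (Φ · ·)) V ξ - derivExt (N X) (derivExt (N Y) (Φ · ·)) V ξ -
        (derivExt (N (N X Y)) (Φ · ·) V ξ - derivExt (N (N Y X)) (Φ · ·) V ξ) := by
    rw [hcurv, derivExt_sub, ← derivExt_derivExt_sub, derivExt_sub]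
    rfl
  change D₂Φ W ξ - D₂Φ (W ∘ swap 0 1) ξ = curvatureHom D ![X, Y] (Φ V ξ) -
    Φ V (curvatureHom D' ![X, Y] ξ) - derivExt (curvatureHom N ![X, Y]) (Φ · ·) V ξ
  simp only [D₂Φ]
  rw [hK, inducedD_inducedD_apply, inducedD_inducedD_apply]
  simp only [h₀, h₁, hV, curvatureHom, Matrix.cons_val, hN X Y, map_sub, AddMonoidHom.sub_apply,
    AddMonoidHom.comp_apply]
  abel

theorem IsTorsionFree.alt_update_curvature (hN : IsTorsionFree N)
    (Φ : MultilinearMap ℤ (fun _ : Fin k ↦ 𝔛) (Γ →+ Γ)) (i : Fin k) :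
    alt (fun (W : Fin (k + 2) → 𝔛) (ξ : Γ) ↦ Φ (Function.update (W ∘ Fin.addNatEmb 2) i
      (curvatureHom N ![W 0, W 1] (W (i.addNat 2)))) ξ) = 0 := by
  have h0 : i.addNat 2 ≠ 0 := by simp [Fin.ext_iff]
  have h1 : i.addNat 2 ≠ 1 := by simp [Fin.ext_iff]
  let τ : Perm (Fin (k + 2)) := swap 0 1 * swap 1 (i.addNat 2)
  have hτ₀ : τ 0 = 1 := by simp [τ, swap_apply_of_ne_of_ne, h0.symm]
  have hτ₁ : τ 1 = i.addNat 2 := by simp [τ, swap_apply_of_ne_of_ne, h0, h1]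
  have hτ₂ : τ (i.addNat 2) = 0 := by simp [τ]
  have hτ (W : Fin (k + 2) → 𝔛) (Z : 𝔛) : Function.update ((W ∘ τ) ∘ Fin.addNatEmb 2) i Z =
      Function.update (W ∘ Fin.addNatEmb 2) i Z := by
    funext l
    rcases eq_or_ne l i with rfl | hl
    · simp only [Function.update_self]
    · simp only [Function.update_of_ne hl]
      refine congrArg W ?_
      have hl' : l.addNat 2 ≠ i.addNat 2 := by simpa [Fin.ext_iff] using hl
      change swap 0 1 (swap 1 (i.addNat 2) (l.addNat 2)) = l.addNat 2
      rw [swap_apply_of_ne_of_ne (by simp [Fin.ext_iff]) hl',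
        swap_apply_of_ne_of_ne (by simp [Fin.ext_iff]) (by simp [Fin.ext_iff])]
  refine alt_eq_zero_of_cyclic (τ := τ) ?_ (funext₂ fun W ξ ↦ ?_)
  · simp [τ, Perm.sign_mul, h1.symm]
  · have hB := hN.curvature_cyclic (W 0) (W 1) (W (i.addNat 2))
    simp only [EndTensor.permute, Pi.add_apply, Perm.coe_mul, ← Function.comp_assoc, hτ]
    simp only [Function.comp_apply, hτ₀, hτ₁, hτ₂, ← AddMonoidHom.add_apply,
      ← Φ.map_update_add, hB]
    rw [Φ.map_update_zero]
    rfl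

theorem IsTorsionFree.alt_derivExt_curvature (hN : IsTorsionFree N)
    (Φ : MultilinearMap ℤ (fun _ : Fin k ↦ 𝔛) (Γ →+ Γ)) :
    alt (fun W ↦ derivExt (curvatureHom N ![W 0, W 1]) (Φ · ·) (W ∘ Fin.addNatEmb 2)) = 0 := by
  let K (i : Fin k) : EndTensor E F S (k + 2) := fun W ξ ↦
    Φ (Function.update (W ∘ Fin.addNatEmb 2) i (curvatureHom N ![W 0, W 1] (W (i.addNat 2)))) ξ
  have hsum : (fun W ↦ derivExt (curvatureHom N ![W 0, W 1]) (Φ · ·) (W ∘ Fin.addNatEmb 2)) =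
      ∑ i, K i := by
    funext W ξ
    simp only [Finset.sum_apply, K]
    rfl
  rw [hsum]
  exact (map_sum (altLinearMap E F S (k + 2)) K _).trans
    (Finset.sum_eq_zero fun i _ ↦ hN.alt_update_curvature Φ i)

theorem IsTorsionFree.two_smul_alt_inducedD_inducedD (hN : IsTorsionFree N)
    (Φ : MultilinearMap ℤ (fun _ : Fin k ↦ 𝔛) (Γ →+ Γ)) :
    (2 : ℝ) • alt (inducedD (N · ·) (D · ·) (D' · ·) (inducedD (N · ·) (D · ·) (D' · ·) (Φ · ·))) =
      alt (comm (curvature (D · ·)) (curvature (D' · ·)) (Φ · ·)) := by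
  have h := congrArg (altLinearMap E F S (k + 2))
    (hN.inducedD_inducedD_sub_permute (D := D) (D' := D') Φ)
  rw [map_sub (altLinearMap E F S (k + 2)) (comm _ _ _)] at h
  rw [two_smul_alt_of_sign_eq_neg_one _ (Perm.sign_swap Fin.zero_ne_one)]
  exact h.trans <| (congrArg _ (hN.alt_derivExt_curvature Φ)).trans (sub_zero _)

theorem IsTorsionFree.alt_inducedD_two_smul_alt_inducedD (hN : IsTorsionFree N)
    (Φ : MultilinearMap ℤ (fun _ : Fin k ↦ 𝔛) (Γ →+ Γ)) :
    alt (inducedD (N · ·) (D · ·) (D' · ·)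
        ((2 : ℝ) • alt (inducedD (N · ·) (D · ·) (D' · ·) (Φ · ·)))) =
      alt (comm (curvature (D · ·)) (curvature (D' · ·)) (Φ · ·)) := by
  rw [two_smul, inducedD_add, ← two_smul ℝ, alt_smul, inducedD_alt, alt_partialAlt,
    hN.two_smul_alt_inducedD_inducedD]

theorem IsTorsionFree.alt_inducedD_comm_curvature (hN : IsTorsionFree N)
    (Φ : (Fin k → 𝔛) → Γ →+ Γ) :
    alt (inducedD (N · ·) (D · ·) (D' · ·)
        (comm (curvature (D · ·)) (curvature (D' · ·)) (Φ · ·))) =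
      (1 / 2 : ℝ) • alt (comm (curvature (D · ·)) (curvature (D' · ·))
        ((2 : ℝ) • alt (inducedD (N · ·) (D · ·) (D' · ·) (Φ · ·)))) := by
  have hleft : alt (comm (inducedD (N · ·) (D · ·) (D · ·) (curvature (D · ·)))
      (inducedD (N · ·) (D' · ·) (D' · ·) (curvature (D' · ·))) (Φ · ·)) = 0 := by
    rw [← alt_partialAlt (Fin.castLEEmb (Nat.le_add_left 3 k)), ← comm_alt_left,
      hN.alt_inducedD_curvature, hN.alt_inducedD_curvature]
    refine (congrArg alt ?_).trans (map_zero (altLinearMap E F S (k + 3)))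
    funext W ξ
    simp [comm]
  simp only [curvature_eq_curvatureHom] at hleft ⊢
  rw [inducedD_comm, alt_add, hleft, zero_add, alt_permute, Perm.viaFintypeEmbedding_sign,
    sign_finRotate, two_smul, comm_add_right, ← two_smul ℝ, alt_smul, smul_smul, comm_alt_right,
    alt_partialAlt]
  norm_num

end TorsionFree

end Tensors

section Connections

variable {E : Type*} [NormedAddCommGroup E] [NormedSpace ℝ E]
  {M : Type*} [TopologicalSpace M] [ChartedSpace E M] [IsManifold 𝓘(ℝ, E) ∞ M]
  {F : Type*} [NormedAddCommGroup F] [NormedSpace ℝ F]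
  {S : M → Type*} [TopologicalSpace (TotalSpace F S)]
  [∀ x, AddCommGroup (S x)] [∀ x, Module ℝ (S x)]
  [∀ x, TopologicalSpace (S x)] [∀ x, IsTopologicalAddGroup (S x)] [∀ x, ContinuousSMul ℝ (S x)]
  [FiberBundle F S] [VectorBundle ℝ F S] [ContMDiffVectorBundle ∞ F S 𝓘(ℝ, E)]

/-- A smooth connection as a biadditive operator on vector fields and sections. -/
def alongHom (D : CovariantDerivative 𝓘(ℝ, E) F S) (hD : D.ContMDiffCovariantDerivative ∞) :
    VField E M →+ Cₛ^∞⟮𝓘(ℝ, E); F, S⟯ →+ Cₛ^∞⟮𝓘(ℝ, E); F, S⟯ :=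
  AddMonoidHom.mk' (fun X ↦ AddMonoidHom.mk' (along D hD X) fun ξ η ↦ by
    ext x
    exact congrArg (fun T ↦ T (X x)) <| D.isCovariantDerivativeOn.add (x := x)
      ξ.mdifferentiableAt η.mdifferentiableAt (Set.mem_univ x)) fun X Y ↦ by
    ext ξ x
    exact (D ξ x).map_add (X x) (Y x)

theorem along_functionSMul (D : CovariantDerivative 𝓘(ℝ, E) F S)
    (hD : D.ContMDiffCovariantDerivative ∞) (X : VField E M) {f : M → ℝ}
    (hf : ContMDiff 𝓘(ℝ, E) 𝓘(ℝ, ℝ) ∞ f) (ξ : Cₛ^∞⟮𝓘(ℝ, E); F, S⟯) (x : M) :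
    along D hD X (functionSMul f hf ξ) x =
      f x • along D hD X ξ x + mvfderiv 𝓘(ℝ, E) f x (X x) • ξ x :=
  congrArg (fun T ↦ T (X x)) <| D.isCovariantDerivativeOn.leibniz (x := x)
    ξ.mdifferentiableAt ((hf x).mdifferentiableAt (by simp)) (Set.mem_univ x)

theorem IsLeviCivita.isTorsionFree [FiniteDimensional ℝ E] {g : PseudoRiemannianMetric E M}
    {nabla : CovariantDerivative 𝓘(ℝ, E) E (TangentSpace 𝓘(ℝ, E) : M → Type _)}
    (hLC : IsLeviCivita g nabla) : IsTorsionFree (alongHom nabla hLC.contMDiff) := by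
  intro X Y
  ext x
  exact (nabla.torsion_eq_zero_iff.mp hLC.torsion_eq_zero X.mdifferentiableAt
    Y.mdifferentiableAt).symm

end Connections

section Parity

variable {E : Type*} [NormedAddCommGroup E] [NormedSpace ℝ E]
  {M : Type*} [TopologicalSpace M] [ChartedSpace E M] [IsManifold 𝓘(ℝ, E) ∞ M]
  {F : Type*} [NormedAddCommGroup F] [NormedSpace ℝ F]
  {S : M → Type*} [TopologicalSpace (TotalSpace F S)]
  [∀ x, AddCommGroup (S x)] [∀ x, Module ℝ (S x)] [∀ x, TopologicalSpace (S x)]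
  [FiberBundle F S] [VectorBundle ℝ F S] {k : ℕ} {Φ : EndTensor E F S k}

/-- The operators `Φ(X₁, …, X_k)` commute with `-1`. This is all the linearity of `Φ` that is
needed to move the sign in `R^C = -R^{D^C}` out of `Φ`. -/
def EndTensor.IsOdd (Φ : EndTensor E F S k) : Prop :=
  ∀ X ξ, Φ X (-ξ) = -Φ X ξ

theorem EndTensor.IsOdd.alt (hΦ : Φ.IsOdd) : (alt Φ).IsOdd := fun X ξ ↦ by
  simp only [SpinorTorsion.alt, hΦ _ _, smul_neg, Finset.sum_neg_distrib]

theorem EndTensor.IsOdd.smul (hΦ : Φ.IsOdd) (c : ℝ) : EndTensor.IsOdd (c • Φ) := fun X ξ ↦ by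
  simp only [Pi.smul_apply, hΦ _ _, smul_neg]

theorem EndTensor.IsOdd.inducedD (hΦ : Φ.IsOdd) (N : VField E M → VField E M → VField E M)
    (D D' : VField E M →+ Cₛ^∞⟮𝓘(ℝ, E); F, S⟯ →+ Cₛ^∞⟮𝓘(ℝ, E); F, S⟯) :
    (inducedD N (D · ·) (D' · ·) Φ).IsOdd := fun W ξ ↦ by
  simp only [SpinorTorsion.inducedD, hΦ _ _, map_neg, Finset.sum_neg_distrib]
  abel

end Parity

section Spinors

variable {𝕜 : Type*} [RCLike 𝕜]
  {E : Type*} [NormedAddCommGroup E] [NormedSpace ℝ E]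
  {M : Type*} [TopologicalSpace M] [ChartedSpace E M]
  {F : Type*} [NormedAddCommGroup F] [NormedSpace ℝ F]
  {S : M → Type*} [TopologicalSpace (TotalSpace F S)]
  [∀ x, AddCommGroup (S x)] [∀ x, Module ℝ (S x)] [∀ x, Module 𝕜 (S x)]
  [∀ x, TopologicalSpace (S x)] [FiberBundle F S]

/-- Product of a constant of `𝕜` and a smooth section. -/
def constSMul [NormedSpace 𝕜 F] [IsScalarTower ℝ 𝕜 F] [VectorBundle 𝕜 F S]
    (c : 𝕜) (ξ : Cₛ^∞⟮𝓘(ℝ, E); F, S⟯) : Cₛ^∞⟮𝓘(ℝ, E); F, S⟯ :=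
  ⟨fun x ↦ c • ξ x, fun x₀ ↦ by
    have h := ξ.contMDiff x₀
    rw [contMDiffAt_section] at h ⊢
    let T : F →L[ℝ] F := (c • ContinuousLinearMap.id 𝕜 F).restrictScalars ℝ
    refine ((T.contMDiff).contMDiffAt.comp x₀ h).congr_of_eventuallyEq ?_
    filter_upwards [(trivializationAt F S x₀).open_baseSet.mem_nhds
      (FiberBundle.mem_baseSet_trivializationAt' x₀)] with x hx
    exact ((trivializationAt F S x₀).linear 𝕜 hx).map_smul c (ξ x)⟩

namespace SpinorStructure

variable [IsManifold 𝓘(ℝ, E) ∞ M] [∀ x, IsScalarTower ℝ 𝕜 (S x)]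
  {g : PseudoRiemannianMetric E M} (𝒮 : SpinorStructure 𝕜 F S g)

/-- The real part of the charge conjugation. -/
def reC (x : M) : LinearMap.BilinForm ℝ (S x) :=
  LinearMap.mk₂ ℝ (fun v w ↦ RCLike.re (𝒮.C x v w)) (by simp)
    (fun r v w ↦ by
      rw [(𝒮.C x).map_smul_of_tower, LinearMap.smul_apply, RCLike.smul_re, smul_eq_mul])
    (by simp)
    (fun r v w ↦ by
      rw [(𝒮.C x v).map_smul_of_tower, RCLike.smul_re, smul_eq_mul])

theorem reC_apply (x : M) (v w : S x) : 𝒮.reC x v w = RCLike.re (𝒮.C x v w) := rfl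

theorem reC_nondegenerate (x : M) : (𝒮.reC x).Nondegenerate := by
  refine ⟨fun v hv ↦ (𝒮.nondegenerate x).1 v fun w ↦ ?_,
    fun w hw ↦ (𝒮.nondegenerate x).2 w fun v ↦ ?_⟩
  · have h := hv ((starRingEnd 𝕜) (𝒮.C x v w) • w)
    rw [reC_apply, map_smul, smul_eq_mul, RCLike.conj_mul, ← RCLike.ofReal_pow,
      RCLike.ofReal_re] at h
    simpa using h
  · have h := hw ((starRingEnd 𝕜) (𝒮.C x v w) • v)
    rw [reC_apply, map_smul, LinearMap.smul_apply, smul_eq_mul, RCLike.conj_mul,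
      ← RCLike.ofReal_pow, RCLike.ofReal_re] at h
    simpa using h

theorem mdifferentiableAt_C (η ξ : Cₛ^∞⟮𝓘(ℝ, E); F, S⟯) (x : M) :
    MDifferentiableAt 𝓘(ℝ, E) 𝓘(ℝ, 𝕜) (fun y ↦ 𝒮.C y (η y) (ξ y)) x :=
  (𝒮.contMDiff_C η ξ x).mdifferentiableAt (by simp)

variable [VectorBundle ℝ F S]

/-- Clifford multiplication as a biadditive operator, in the form of a multilinear map in one
argument. -/
def gammaMultilinear : MultilinearMap ℤ (fun _ : Fin 1 ↦ VField E M)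
    (Cₛ^∞⟮𝓘(ℝ, E); F, S⟯ →+ Cₛ^∞⟮𝓘(ℝ, E); F, S⟯) :=
  MultilinearMap.ofSubsingleton ℤ _ _ 0 <| AddMonoidHom.toIntLinearMap <|
    AddMonoidHom.mk' (fun X ↦ AddMonoidHom.mk' (𝒮.gamma fun _ ↦ X) fun ξ η ↦ by
      ext x
      exact (𝒮.γ x (X x)).map_add (ξ x) (η x)) fun X Y ↦ by
      ext ξ x
      exact congrArg (fun T ↦ T (ξ x)) ((𝒮.γ x).map_add (X x) (Y x))

theorem isOdd_gamma : EndTensor.IsOdd 𝒮.gamma := fun X ↦ map_neg (𝒮.gammaMultilinear X)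

section DualFunctional

variable [∀ x, IsTopologicalAddGroup (S x)] [∀ x, ContinuousSMul ℝ (S x)]
  [ContMDiffVectorBundle ∞ F S 𝓘(ℝ, E)] (D : SpinorConnection 𝕜 E F S)

/-- The function `X C(η, ξ) - C(D_X η, ξ)`, which `D^C_X ξ` represents through `C(η, ·)`. -/
def dualFunctional (X : VField E M) (ξ η : Cₛ^∞⟮𝓘(ℝ, E); F, S⟯) (x : M) : 𝕜 :=
  mvfderiv 𝓘(ℝ, E) (fun y ↦ 𝒮.C y (η y) (ξ y)) x (X x) - 𝒮.C x (D.apply X η x) (ξ x)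

theorem contMDiff_dualFunctional (X : VField E M) (ξ η : Cₛ^∞⟮𝓘(ℝ, E); F, S⟯) :
    ContMDiff 𝓘(ℝ, E) 𝓘(ℝ, 𝕜) ∞ (𝒮.dualFunctional D X ξ η) :=
  (contMDiff_mvfderiv (𝒮.contMDiff_C η ξ) X).sub (𝒮.contMDiff_C (D.apply X η) ξ)

theorem dualFunctional_add (X : VField E M) (ξ η η' : Cₛ^∞⟮𝓘(ℝ, E); F, S⟯) (x : M) :
    𝒮.dualFunctional D X ξ (η + η') x =
      𝒮.dualFunctional D X ξ η x + 𝒮.dualFunctional D X ξ η' x := by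
  have h := mvfderiv_fun_add (𝒮.mdifferentiableAt_C η ξ x) (𝒮.mdifferentiableAt_C η' ξ x)
  have hD : D.apply X (η + η') = D.apply X η + D.apply X η' :=
    (alongHom D.toCovariantDerivative D.contMDiff X).map_add η η'
  simp only [dualFunctional, hD, ContMDiffSection.coe_add, Pi.add_apply, map_add,
    LinearMap.add_apply, h, add_apply]
  ring

theorem dualFunctional_functionSMul (X : VField E M) (ξ η : Cₛ^∞⟮𝓘(ℝ, E); F, S⟯)
    (f : M → ℝ) (hf : ContMDiff 𝓘(ℝ, E) 𝓘(ℝ, ℝ) ∞ f) (x : M) :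
    𝒮.dualFunctional D X ξ (functionSMul f hf η) x = f x • 𝒮.dualFunctional D X ξ η x := by
  have h := mvfderiv_fun_smul ((hf x).mdifferentiableAt (by simp)) (𝒮.mdifferentiableAt_C η ξ x)
  have hD := along_functionSMul D.toCovariantDerivative D.contMDiff X hf η x
  have hs (y : M) (r : ℝ) (v w : S y) : 𝒮.C y (r • v) w = r • 𝒮.C y v w := by
    rw [(𝒮.C y).map_smul_of_tower, LinearMap.smul_apply]
  simp only [dualFunctional, SpinorConnection.apply, hD, functionSMul_apply, hs, h, map_add,
    LinearMap.add_apply]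
  simp only [add_apply, smul_apply, ContinuousLinearMap.smulRight_apply]
  module

theorem dualFunctional_constSMul [NormedSpace 𝕜 F] [IsScalarTower ℝ 𝕜 F] [VectorBundle 𝕜 F S]
    (X : VField E M) (ξ η : Cₛ^∞⟮𝓘(ℝ, E); F, S⟯) (c : 𝕜) (x : M) :
    𝒮.dualFunctional D X ξ (constSMul c η) x = c * 𝒮.dualFunctional D X ξ η x := by
  have h := mvfderiv_continuousLinearMap_comp (ContinuousLinearMap.mul ℝ 𝕜 c)
    (𝒮.mdifferentiableAt_C η ξ x) (X x)
  have hD : D.apply X (constSMul c η) x = c • D.apply X η x := D.smul_const c η x (X x)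
  have hc (y : M) : constSMul (E := E) c η y = c • η y := rfl
  simp only [ContinuousLinearMap.mul_apply'] at h
  simp only [dualFunctional, hD, hc, map_smul, LinearMap.smul_apply, smul_eq_mul, h]
  ring

end DualFunctional

variable [FiniteDimensional ℝ E] [T2Space M] [FiniteDimensional ℝ F]
  [ContMDiffVectorBundle ∞ F S 𝓘(ℝ, E)]

theorem section_ext {ζ ζ' : Cₛ^∞⟮𝓘(ℝ, E); F, S⟯}
    (h : ∀ (η : Cₛ^∞⟮𝓘(ℝ, E); F, S⟯) x, 𝒮.C x (η x) (ζ x) = 𝒮.C x (η x) (ζ' x)) : ζ = ζ' := by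
  ext x
  rw [← sub_eq_zero]
  refine (𝒮.nondegenerate x).2 _ fun v ↦ ?_
  obtain ⟨η, rfl⟩ := exists_contMDiffSection_apply_eq (E := E) (F := F) x v
  rw [map_sub, h, sub_self]

variable [∀ x, IsTopologicalAddGroup (S x)] [∀ x, ContinuousSMul ℝ (S x)]
  [NormedSpace 𝕜 F] [IsScalarTower ℝ 𝕜 F] [VectorBundle 𝕜 F S] (D : SpinorConnection 𝕜 E F S)

theorem exists_C_eq_dualFunctional (X : VField E M) (ξ : Cₛ^∞⟮𝓘(ℝ, E); F, S⟯) :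
    ∃ ζ : Cₛ^∞⟮𝓘(ℝ, E); F, S⟯, ∀ η x, 𝒮.C x (η x) (ζ x) = 𝒮.dualFunctional D X ξ η x := by
  have hre : ContMDiff 𝓘(ℝ, 𝕜) 𝓘(ℝ, ℝ) ∞ (RCLike.reCLM : 𝕜 →L[ℝ] ℝ) :=
    ContinuousLinearMap.contMDiff _
  let L : Cₛ^∞⟮𝓘(ℝ, E); F, S⟯ →+ (M → ℝ) :=
    AddMonoidHom.mk' (fun η x ↦ RCLike.re (𝒮.dualFunctional D X ξ η x)) fun η η' ↦ by
      funext x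
      simp [dualFunctional_add]
  obtain ⟨ζ, hζ⟩ := exists_section_representing (L := L) 𝒮.reC_nondegenerate
    (fun η ξ ↦ hre.comp (𝒮.contMDiff_C η ξ))
    (fun η ↦ hre.comp (𝒮.contMDiff_dualFunctional D X ξ η))
    (fun f hf η x ↦ by simp [L, dualFunctional_functionSMul, RCLike.smul_re])
  -- `ζ` represents the real part; testing with `z̄ η` recovers `|z|²` for the complex defect `z`.
  refine ⟨ζ, fun η x ↦ ?_⟩
  rw [← sub_eq_zero]
  set z := 𝒮.C x (η x) (ζ x) - 𝒮.dualFunctional D X ξ η x with hz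
  have h : RCLike.re (𝒮.C x ((starRingEnd 𝕜) z • η x) (ζ x)) =
      RCLike.re (𝒮.dualFunctional D X ξ (constSMul ((starRingEnd 𝕜) z) η) x) :=
    hζ (constSMul ((starRingEnd 𝕜) z) η) x
  rw [dualFunctional_constSMul, map_smul, LinearMap.smul_apply, smul_eq_mul, ← sub_eq_zero,
    ← map_sub, ← mul_sub, ← hz, RCLike.conj_mul, ← RCLike.ofReal_pow, RCLike.ofReal_re] at h
  simpa using h

theorem mvfderiv_C (X : VField E M) (ξ η : Cₛ^∞⟮𝓘(ℝ, E); F, S⟯) (x : M) :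
    mvfderiv 𝓘(ℝ, E) (fun y ↦ 𝒮.C y (η y) (ξ y)) x (X x) =
      𝒮.C x (D.apply X η x) (ξ x) + 𝒮.C x (η x) (𝒮.chargeDual D.apply X ξ x) := by
  obtain ⟨ζ, hζ⟩ := 𝒮.exists_C_eq_dualFunctional D X ξ
  refine Classical.epsilon_spec (p := fun ζ : Cₛ^∞⟮𝓘(ℝ, E); F, S⟯ ↦
    ∀ (η : Cₛ^∞⟮𝓘(ℝ, E); F, S⟯) (x : M),
      mvfderiv 𝓘(ℝ, E) (fun y ↦ 𝒮.C y (η y) (ξ y)) x (X x) =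
        𝒮.C x (D.apply X η x) (ξ x) + 𝒮.C x (η x) (ζ x)) ⟨ζ, fun η x ↦ ?_⟩ η x
  rw [hζ, dualFunctional]
  ring

theorem C_chargeDual (X : VField E M) (ξ η : Cₛ^∞⟮𝓘(ℝ, E); F, S⟯) (x : M) :
    𝒮.C x (η x) (𝒮.chargeDual D.apply X ξ x) =
      mvfderiv 𝓘(ℝ, E) (fun y ↦ 𝒮.C y (η y) (ξ y)) x (X x) - 𝒮.C x (D.apply X η x) (ξ x) := by
  rw [mvfderiv_C, add_sub_cancel_left]

/-- The connection `D^C` as a biadditive operator. -/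
def chargeDualHom : VField E M →+ Cₛ^∞⟮𝓘(ℝ, E); F, S⟯ →+ Cₛ^∞⟮𝓘(ℝ, E); F, S⟯ :=
  AddMonoidHom.mk' (fun X ↦ AddMonoidHom.mk' (𝒮.chargeDual D.apply X) fun ξ ξ' ↦ by
    refine 𝒮.section_ext fun η x ↦ ?_
    have h := mvfderiv_fun_add (𝒮.mdifferentiableAt_C η ξ x) (𝒮.mdifferentiableAt_C η ξ' x)
    simp only [C_chargeDual, ContMDiffSection.coe_add, Pi.add_apply, map_add, h, add_apply]
    ring) fun X Y ↦ by
    ext1 ξ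
    refine 𝒮.section_ext fun η x ↦ ?_
    have hD : D.apply (X + Y) η = D.apply X η + D.apply Y η :=
      DFunLike.congr_fun ((alongHom D.toCovariantDerivative D.contMDiff).map_add X Y) η
    simp only [AddMonoidHom.mk'_apply, AddMonoidHom.add_apply, C_chargeDual,
      ContMDiffSection.coe_add, Pi.add_apply, map_add, hD, LinearMap.add_apply]
    ring

theorem C_curvature_chargeDual (X : Fin 2 → VField E M) (η ξ : Cₛ^∞⟮𝓘(ℝ, E); F, S⟯) (x : M) :
    𝒮.C x (η x) (curvature (𝒮.chargeDual D.apply) X ξ x) =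
      -𝒮.C x (curvature D.apply X η x) (ξ x) := by
  have second (X Y : VField E M) :
      mvfderiv 𝓘(ℝ, E) (fun y ↦ mvfderiv 𝓘(ℝ, E) (fun z ↦ 𝒮.C z (η z) (ξ z)) y (Y y)) x (X x) =
      𝒮.C x (D.apply X (D.apply Y η) x) (ξ x) +
        𝒮.C x (D.apply Y η x) (𝒮.chargeDual D.apply X ξ x) +
        (𝒮.C x (D.apply X η x) (𝒮.chargeDual D.apply Y ξ x) +
        𝒮.C x (η x) (𝒮.chargeDual D.apply X (𝒮.chargeDual D.apply Y ξ) x)) := by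
    simp only [𝒮.mvfderiv_C D Y ξ η]
    rw [mvfderiv_fun_add (𝒮.mdifferentiableAt_C _ _ x) (𝒮.mdifferentiableAt_C _ _ x),
      add_apply, 𝒮.mvfderiv_C D X, 𝒮.mvfderiv_C D X]
  have h := mvfderiv_lieBracket (𝒮.contMDiff_C η ξ) (X 0) (X 1) x
  rw [second, second, 𝒮.mvfderiv_C D] at h
  simp only [curvature, ContMDiffSection.coe_sub, Pi.sub_apply, map_sub, LinearMap.sub_apply]
  linear_combination -h

theorem chargeAdjoint_curvature (X : Fin 2 → VField E M) (ξ : Cₛ^∞⟮𝓘(ℝ, E); F, S⟯) :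
    𝒮.chargeAdjoint (curvature D.apply X) ξ = -curvature (𝒮.chargeDual D.apply) X ξ := by
  have hneg (η : Cₛ^∞⟮𝓘(ℝ, E); F, S⟯) (x : M) :
      𝒮.C x ((-curvature (𝒮.chargeDual D.apply) X ξ) x) (η x) =
        𝒮.C x (ξ x) (curvature D.apply X η x) := by
    rw [𝒮.symm₀, 𝒮.symm₀ x (ξ x), ContMDiffSection.coe_neg, Pi.neg_apply, map_neg,
      𝒮.C_curvature_chargeDual D, neg_neg]
  have hadj := Classical.epsilon_spec (p := fun ζ : Cₛ^∞⟮𝓘(ℝ, E); F, S⟯ ↦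
    ∀ (η : Cₛ^∞⟮𝓘(ℝ, E); F, S⟯) (x : M),
      𝒮.C x (ζ x) (η x) = 𝒮.C x (ξ x) (curvature D.apply X η x)) ⟨_, hneg⟩
  refine 𝒮.section_ext fun η x ↦ ?_
  rw [𝒮.symm₀, 𝒮.symm₀ x (η x), hneg η x]
  exact congrArg _ (hadj η x)

theorem adC_curvature {k : ℕ} {Φ : EndTensor E F S k} (hΦ : Φ.IsOdd) :
    𝒮.adC (curvature D.apply) Φ =
      comm (curvature D.apply) (curvature (𝒮.chargeDual D.apply)) Φ := by
  funext W ξ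
  simp only [adC, chargeAdjoint_curvature, hΦ _ _, ← sub_eq_add_neg]
  rfl

variable {nabla : CovariantDerivative 𝓘(ℝ, E) E (TangentSpace 𝓘(ℝ, E) : M → Type _)}
  (hLC : IsLeviCivita g nabla)

theorem isOdd_torsion : EndTensor.IsOdd (𝒮.torsion hLC D) :=
  (𝒮.isOdd_gamma.inducedD _ (alongHom D.toCovariantDerivative D.contMDiff)
    (𝒮.chargeDualHom D)).alt.smul 2

end SpinorStructure

end Spinors

end SpinorTorsion

end

open SpinorTorsion in
theorem proposition3p8
    {𝕜 : Type*} [RCLike 𝕜]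
    -- the manifold
    {E : Type*} [NormedAddCommGroup E] [NormedSpace ℝ E] [FiniteDimensional ℝ E]
    {M : Type*} [TopologicalSpace M] [T2Space M] [ChartedSpace E M] [IsManifold 𝓘(ℝ, E) ∞ M]
    -- the vector bundle
    {F : Type*} [NormedAddCommGroup F] [NormedSpace ℝ F] [NormedSpace 𝕜 F] [IsScalarTower ℝ 𝕜 F]
    [FiniteDimensional ℝ F]
    {S : M → Type*} [TopologicalSpace (TotalSpace F S)]
    [∀ x, AddCommGroup (S x)] [∀ x, Module ℝ (S x)] [∀ x, Module 𝕜 (S x)]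
    [∀ x, IsScalarTower ℝ 𝕜 (S x)]
    [∀ x, TopologicalSpace (S x)] [∀ x, IsTopologicalAddGroup (S x)]
    [∀ x, ContinuousSMul ℝ (S x)]
    [FiberBundle F S] [VectorBundle ℝ F S] [VectorBundle 𝕜 F S]
    [ContMDiffVectorBundle ∞ F S 𝓘(ℝ, E)]
    -- metric, Levi-Civita connection, spinor structure, connection on spinors
    (g : PseudoRiemannianMetric E M)
    (nabla : CovariantDerivative 𝓘(ℝ, E) E (TangentSpace 𝓘(ℝ, E) : M → Type _))
    (hLC : IsLeviCivita g nabla)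
    (𝒮 : SpinorStructure 𝕜 F S g)
    (D : SpinorConnection 𝕜 E F S) :
    alt (𝒮.hatD hLC D (𝒮.torsion hLC D)) = alt (𝒮.adC (curvature D.apply) 𝒮.gamma) ∧
    alt (𝒮.hatD hLC D (𝒮.adC (curvature D.apply) 𝒮.gamma)) =
      (1 / 2 : ℝ) • alt (𝒮.adC (curvature D.apply) (𝒮.torsion hLC D)) ∧
    alt (inducedD (along nabla hLC.contMDiff) D.apply D.apply (curvature D.apply)) = 0 := by
  let d := alongHom D.toCovariantDerivative D.contMDiff
  let d' := 𝒮.chargeDualHom D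
  have hN := hLC.isTorsionFree
  have hR := 𝒮.adC_curvature D (Φ := 𝒮.gamma) 𝒮.isOdd_gamma
  refine ⟨?_, ?_, ?_⟩
  · rw [hR]
    exact hN.alt_inducedD_two_smul_alt_inducedD (D := d) (D' := d') 𝒮.gammaMultilinear
  · rw [hR, 𝒮.adC_curvature D (𝒮.isOdd_torsion D hLC)]
    exact (hN.alt_inducedD_comm_curvature (D := d) (D' := d') 𝒮.gammaMultilinear).trans
      (congrArg ((1 / 2 : ℝ) • ·) rfl)
  · exact hN.alt_inducedD_curvature (D := d)
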